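/- **Setting.** Let $\rho$ be a measure concentrated on $(0,\infty)$ with $\int\min(1,r)\,\rho(dr)<\infty$, let $\Omega$ be a measurable space with a countable family of measurable sets separating its points (e.g. any standard Borel space), let $G_0$ be a finite, nonzero measure on $\Omega$ with $G_0(\{\omega\})=0$ for every $\omega$, put $\gamma_0=G_0(\Omega)$ and $g_0=G_0/\gamma_0$, and let $\kappa$ be a Markov kernel from $\Omega$ to a measurable space $\mathcal X$. Let $G=\sum_k r_k\delta_{\omega_k}$ (finitely or countably many atoms, the $\omega_k$ with $r_k>0$ being a.s. distinct) be a completely random measure with Lévy measure $\rho(dr)G_0(d\omega)$: $G(\Omega)<\infty$ a.s., $G$ takes independent values on disjoint measurable sets, and $$\mathbb E\,e^{iuG(A)}=\exp\Big\{\int_A\int (e^{iur}-1)\,\rho(dr)\,G_0(d\omega)\Big\}$$ for all real $u$ and measurable $A\subset\Omega$. The *count-mixture model* is: given $(r_k,\omega_k)_k$, draw $m\sim\mathrm{Pois}(G(\Omega))$; given also $m$, draw $z_1,\dots,z_m$ iid from $\sum_k \frac{r_k}{G(\Omega)}\delta_k$; given also these, draw $x_i\sim\kappa(\omega_{z_i})$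 independently for $i=1,\dots,m$. (If $G(\Omega)=0$ then $m=0$.) The occupied atoms are then relabelled $1,\dots,l$ in order of appearance in $z_1,\dots,z_m$, so that $z_i\in\{1,\dots,l\}$; from now on $\boldsymbol z=(z_1,\dots,z_m)$ and $\omega_1,\dots,\omega_l$ denote the relabelled labels and atoms. **Functions.** For $\boldsymbol z\in\{1,\dots,l\}^m$ using all of $1,\dots,l$, numbered in order of appearance, with $n_k=\#\{i:z_i=k\}$, let $$f(\boldsymbol z,m\mid\gamma_0,\rho)=\frac{\gamma_0^l}{m!}\,e^{\gamma_0\int(e^{-r}-1)\rho(dr)}\prod_{k=1}^l\int r^{n_k}e^{-r}\rho(dr),$$ let $$f_M(m\mid\gamma_0,\rho)=\frac1{m!}\,\frac{d^m}{dt^m}\,e^{\gamma_0\int(e^{-(1-t)r}-1)\rho(dr)}\Big|_{t=0},$$ and let $f(\boldsymbol z\mid m,\gamma_0,\rho)=f(\boldsymbol z,m\mid\gamma_0,\rho)/f_M(m\mid\gamma_0,\rho)$ (the exchangeable partition probability function, EPPF). **Corollary (Equivalent Construction).** In the count-mixture model, $f_M(\cdot\mid\gamma_0,\rho)$ is a probability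 mass function and is the marginal law of $m$; the EPPF is nonnegative and, for every $m$ with $f_M(m\mid\gamma_0,\rho)\neq0$, $f(\cdot\mid m,\gamma_0,\rho)$ is a probability mass function and is the conditional law of $\boldsymbol z$ given $m$. Moreover the joint law of $\big(m,\,l,\,\boldsymbol z,\,(\omega_1,\dots,\omega_l),\,(x_1,\dots,x_m)\big)$ in the count-mixture model equals the law produced by the two-step construction: draw $m\sim f_M(m\mid\gamma_0,\rho)$, then $\boldsymbol z\sim f(\boldsymbol z\mid m,\gamma_0,\rho)$; given these, draw $\omega_1,\dots,\omega_l$ iid from $g_0$, and finally $x_i\sim\kappa(\omega_{z_i})$ independently for $i=1,\dots,m$. -/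

import Mathlib

open MeasureTheory ProbabilityTheory
open scoped NNReal ENNReal

noncomputable section

namespace CountMixture

/-! ### Homogeneous completely random measures -/

/-- `ρ` is a Lévy measure on the positive half-line: it charges only `(0, ∞)` and integrates
`min 1 r`. -/
structure IsLevyMeasure (ρ : Measure ℝ) : Prop where
  nonpos_null : ρ (Set.Iic 0) = 0
  lintegral_min_lt_top : ∫⁻ r, ENNReal.ofReal (min 1 r) ∂ρ < ∞

/-- `G` is a completely random measure with Lévy measure `ρ(dr) G₀(dω)`: its values on disjoint
sets are independent, `E[exp(i u G(A))] = exp(∫_A ∫ (exp(i u r) - 1) ρ(dr) G₀(dω))`, and its total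
mass is almost surely finite. -/
structure IsCompletelyRandomMeasure {S Ω : Type*} [MeasurableSpace S] [MeasurableSpace Ω]
    (P : Measure S) (G : S → Measure Ω) (ρ : Measure ℝ) (G₀ : Measure Ω) : Prop where
  measurable_eval : ∀ A : Set Ω, MeasurableSet A → Measurable fun s => G s A
  ae_finite : ∀ᵐ s ∂P, G s Set.univ < ∞
  indep : ∀ (n : ℕ) (A : Fin n → Set Ω), (∀ i, MeasurableSet (A i)) →
    Pairwise (fun i j => Disjoint (A i) (A j)) → iIndepFun (fun i s => G s (A i)) P
  characteristic : ∀ A : Set Ω, MeasurableSet A → ∀ u : ℝ,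
    ∫ s, Complex.exp (Complex.I * (u : ℂ) * ((G s A).toReal : ℂ)) ∂P =
      Complex.exp (∫ _ω in A,
        (∫ r, (Complex.exp (Complex.I * (u : ℂ) * (r : ℂ)) - 1) ∂ρ) ∂G₀)

/-- The measure `∑ₖ rₖ δ_{ωₖ}`. A measure with only `K < ∞` atoms is obtained with `rₖ = 0` for
`k ≥ K`. -/
def atomicMeasure {Ω : Type*} [MeasurableSpace Ω] (r : ℕ → ℝ≥0) (ω : ℕ → Ω) : Measure Ω :=
  Measure.sum fun k => (r k : ℝ≥0∞) • Measure.dirac (ω k)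

/-! ### The count-mixture model -/

/-- The conditional likelihood `f(z, m | G) = Pois(m; G(Ω)) ∏ᵢ r_{zᵢ} / G(Ω)`, where
`G(Ω) = ∑ₖ rₖ`. -/
def likelihood (r : ℕ → ℝ≥0) {m : ℕ} (z : Fin m → ℕ) : ℝ≥0∞ :=
  poissonMeasure (∑' k, r k) {m} * ∏ i, ((r (z i) / ∑' k, r k : ℝ≥0) : ℝ≥0∞)

/-- The random variables `(r, ω, m, z, x)` on `(S, P)` follow the count-mixture model
`xᵢ ∼ κ(ω_{zᵢ})`, `zᵢ ∼ ∑ₖ (rₖ / G(Ω)) δₖ`, `m ∼ Pois(G(Ω))`, `i = 1, …, m`,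
where `G = ∑ₖ rₖ δ_{ωₖ}` (with distinct atoms) is a completely random measure with Lévy measure
`ρ(dr) G₀(dω)`. The field `conditional_law` gives the conditional law of `(m, z₁, …, z_m, x₁, …, x_m)`
given `(rₖ, ωₖ)ₖ`; nothing is said about `zᵢ` and `xᵢ` beyond the sample size. -/
structure IsCountMixture {S Ω X : Type*} [MeasurableSpace S] [MeasurableSpace Ω]
    [MeasurableSpace X] (P : Measure S) (ρ : Measure ℝ) (G₀ : Measure Ω) (κ : Kernel Ω X)
    (r : ℕ → S → ℝ≥0) (ω : ℕ → S → Ω) (m : S → ℕ) (z : ℕ → S → ℕ) (x : ℕ → S → X) : Prop where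
  measurable_weight : ∀ k, Measurable (r k)
  measurable_atom : ∀ k, Measurable (ω k)
  measurable_size : Measurable m
  measurable_label : ∀ i, Measurable (z i)
  measurable_obs : ∀ i, Measurable (x i)
  completelyRandom :
    IsCompletelyRandomMeasure P (fun s => atomicMeasure (fun k => r k s) (fun k => ω k s)) ρ G₀
  distinct : ∀ᵐ s ∂P, ∀ j k, j ≠ k → 0 < r j s → 0 < r k s → ω j s ≠ ω k s
  conditional_law : ∀ (n : ℕ) (y : Fin n → ℕ) (B : Fin n → Set X), (∀ i, MeasurableSet (B i)) →
    ∀ A : Set ((ℕ → ℝ≥0) × (ℕ → Ω)), MeasurableSet A →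
      P {s | (fun k => r k s, fun k => ω k s) ∈ A ∧ m s = n ∧
          (∀ i : Fin n, z i s = y i) ∧ ∀ i : Fin n, x i s ∈ B i} =
        ∫⁻ s in {s | (fun k => r k s, fun k => ω k s) ∈ A},
          likelihood (fun k => r k s) y * ∏ i : Fin n, κ (ω (y i) s) (B i) ∂P

/-! ### Relabelling the clusters in order of appearance

Labels in order of appearance are counted from `0`: they are `0, …, l - 1`. -/

/-- The first index carrying the same label as `i`. -/
def firstIndex {m : ℕ} (z : Fin m → ℕ) (i : Fin m) : Fin m :=
  (Finset.univ.filter fun j => z j = z i).min' ⟨i, by simp⟩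

/-- The indices at which a new label appears. -/
def firstIndices {m : ℕ} (z : Fin m → ℕ) : Finset (Fin m) :=
  Finset.univ.image (firstIndex z)

/-- The number `l` of clusters. -/
def numClusters {m : ℕ} (z : Fin m → ℕ) : ℕ := (firstIndices z).card

/-- The increasing enumeration of the indices at which a new label appears. -/
def appearance {m : ℕ} (z : Fin m → ℕ) : Fin (numClusters z) ≃o firstIndices z :=
  (firstIndices z).orderIsoOfFin rfl

/-- The labels after relabelling in order of appearance. -/
def relabel {m : ℕ} (z : Fin m → ℕ) (i : Fin m) : Fin (numClusters z) :=
  (appearance z).symm ⟨firstIndex z i, Finset.mem_image_of_mem _ (Finset.mem_univ i)⟩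

/-- The original label of the `k`-th cluster in order of appearance. -/
def originalLabel {m : ℕ} (z : Fin m → ℕ) (k : Fin (numClusters z)) : ℕ :=
  z (appearance z k : Fin m)

/-- The labels `z` use exactly `l` values and number them in order of appearance. -/
def IsAppearanceOrdered {m l : ℕ} (z : Fin m → Fin l) : Prop :=
  Function.Surjective z ∧
    ∀ j k : Fin l, j < k → ∃ i, z i = j ∧ ∀ i', z i' = k → i < i'

/-- The space of outcomes `(m, l, z, (ω₁, …, ω_l), (x₁, …, x_m))`: sample size, number of clusters,
labels, atoms of the clusters, observations. -/
abbrev Outcome (Ω X : Type*) : Type _ :=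
  (p : ℕ × ℕ) × ((Fin p.1 → Fin p.2) × (Fin p.2 → Ω) × (Fin p.1 → X))

/-- The labels `(l, z)` of a sample of size `m`. -/
abbrev Labels (m : ℕ) : Type := (l : ℕ) × (Fin m → Fin l)

/-- The outcome of a sample `x₁, …, x_m` with labels `z₁, …, z_m` and atoms `ωₖ`, after relabelling
the occupied atoms in order of appearance. -/
def outcome {Ω X : Type*} {m : ℕ} (ω : ℕ → Ω) (z : Fin m → ℕ) (x : Fin m → X) : Outcome Ω X :=
  ⟨(m, numClusters z), relabel z, fun k => ω (originalLabel z k), x⟩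

/-! ### ECPF, marginal of the sample size, EPPF -/

open scoped Classical in
/-- The exchangeable cluster probability function
`f(z, m | γ₀, ρ) = (γ₀ˡ / m!) exp(γ₀ ∫ (e⁻ʳ - 1) ρ(dr)) ∏ₖ ∫ r^{nₖ} e⁻ʳ ρ(dr)`,
for labels in order of appearance. -/
def ecpf (γ₀ : ℝ) (ρ : Measure ℝ) {m l : ℕ} (z : Fin m → Fin l) : ℝ :=
  if IsAppearanceOrdered z then
    γ₀ ^ l / (m.factorial : ℝ) * Real.exp (γ₀ * ∫ r, (Real.exp (-r) - 1) ∂ρ) *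
      ∏ k : Fin l, ∫ r, r ^ (Finset.univ.filter fun i => z i = k).card * Real.exp (-r) ∂ρ
  else 0

/-- The probability generating function `exp(γ₀ ∫ (e^{-(1-t)r} - 1) ρ(dr))` of the sample size. -/
def sizePGF (γ₀ : ℝ) (ρ : Measure ℝ) (t : ℝ) : ℝ :=
  Real.exp (γ₀ * ∫ r, (Real.exp (-(1 - t) * r) - 1) ∂ρ)

/-- The probability mass function `f_M(m | γ₀, ρ)` of the sample size: the `m`-th Taylor
coefficient at `0` of the probability generating function. -/
def sizePMF (γ₀ : ℝ) (ρ : Measure ℝ) (m : ℕ) : ℝ :=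
  iteratedDeriv m (sizePGF γ₀ ρ) 0 / (m.factorial : ℝ)

/-- The exchangeable partition probability function
`f(z | m, γ₀, ρ) = f(z, m | γ₀, ρ) / f_M(m | γ₀, ρ)`. -/
def eppf (γ₀ : ℝ) (ρ : Measure ℝ) {m l : ℕ} (z : Fin m → Fin l) : ℝ :=
  ecpf γ₀ ρ z / sizePMF γ₀ ρ m

/-! ### The two-step construction -/

/-- The law on `ℕ` with probability mass function `f_M`. -/
def sizeLaw (γ₀ : ℝ) (ρ : Measure ℝ) : Measure ℕ :=
  Measure.sum fun m => ENNReal.ofReal (sizePMF γ₀ ρ m) • Measure.dirac m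

/-- The law of the labels of a sample of size `m` given by the EPPF. -/
def labelLaw (γ₀ : ℝ) (ρ : Measure ℝ) (m : ℕ) : Measure (Labels m) :=
  Measure.sum fun q : Labels m => ENNReal.ofReal (eppf γ₀ ρ q.2) • Measure.dirac q

/-- The base distribution `g₀ = G₀ / γ₀`. -/
def baseLaw {Ω : Type*} [MeasurableSpace Ω] (G₀ : Measure Ω) : Measure Ω :=
  (G₀ Set.univ)⁻¹ • G₀

/-- Independent observations `xᵢ ∼ κ(ω_{zᵢ})` given the atoms `ω₁, …, ω_l`. -/
def observationKernel {Ω X : Type*} [MeasurableSpace Ω] [MeasurableSpace X]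
    (κ : Kernel Ω X) [IsMarkovKernel κ] {m l : ℕ} (z : Fin m → Fin l) :
    Kernel (Fin l → Ω) (Fin m → X) where
  toFun w := Measure.pi fun i => κ (w (z i))
  measurable' := by
    refine Measurable.measure_of_isPiSystem_of_isProbabilityMeasure
      (S := Set.pi Set.univ '' Set.pi Set.univ fun _ : Fin m => {s : Set X | MeasurableSet s})
      generateFrom_pi.symm isPiSystem_pi ?_
    rintro _ ⟨B, hB, rfl⟩
    simp only [Measure.pi_pi]
    exact Finset.measurable_prod _ fun i _ =>
      (κ.measurable_coe (hB i (Set.mem_univ i))).comp (measurable_pi_apply (z i))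

/-- Given the sample size and the labels: atoms `ω₁, …, ω_l` iid from `g₀`, then observations
`xᵢ ∼ κ(ω_{zᵢ})`. -/
def outcomeLaw {Ω X : Type*} [MeasurableSpace Ω] [MeasurableSpace X]
    (G₀ : Measure Ω) (κ : Kernel Ω X) [IsMarkovKernel κ] {m l : ℕ} (z : Fin m → Fin l) :
    Measure (Outcome Ω X) :=
  ((Measure.pi fun _ : Fin l => baseLaw G₀) ⊗ₘ observationKernel κ z).map
    fun wx => ⟨(m, l), z, wx.1, wx.2⟩

/-- The two-step construction: `m ∼ f_M`, then `z ∼ f(z | m)`, then atoms `ωₖ ∼ g₀` and observations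
`xᵢ ∼ κ(ω_{zᵢ})`. -/
def twoStepLaw {Ω X : Type*} [MeasurableSpace Ω] [MeasurableSpace X]
    (ρ : Measure ℝ) (G₀ : Measure Ω) (κ : Kernel Ω X) [IsMarkovKernel κ] :
    Measure (Outcome Ω X) :=
  (sizeLaw (G₀.real Set.univ) ρ).bind fun m =>
    (labelLaw (G₀.real Set.univ) ρ m).bind fun q => outcomeLaw G₀ κ q.2

end CountMixture

end

noncomputable section

open Filter Topology

namespace CountMixture

/-! ### Measures off the diagonal -/

/-! The proof needs no Poisson-process (Palm) calculus: the label law is read off from the atoms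
actually sampled. Let `M` be the law of `(ω_{z₁}, …, ω_{zₙ})` on the event `m = n`
(`sampledAtomLaw`). Summing the likelihood over all label sequences eliminates the individual
weights and leaves `M(∏ Dᵢ) = E[e^{-G(Ω)} / n! · ∏ G(Dᵢ)]` (`sampledAtomLaw_rectangle`).

If the sides are disjoint sets `D_k`, each repeated `n_k` times, independence factors this into
tilted moments `E[G(D)ⁿ e^{-G(D)}]`. The characteristic function determines the Laplace transform
(`mgf_eq_exp_levyExponent`, by Phragmén–Lindelöf). Differentiating it at `-1` gives `Qₙ(a)` times an
exponential, where `a = G₀(D)` and `Qₙ` is a polynomial with `Qₙ(0) = 0` and linear coefficient `∫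
rⁿ e⁻ʳ ρ(dr)` for `n ≥ 1`.

Now refine `Ω` into ever smaller cells and add up the rectangles with distinct cells for distinct
clusters. Since `G₀` has no atoms, cell masses tend to zero and only the linear terms of the `Qₙ`
survive. Hence `M`, restricted to the points with a given pattern of coincidences, is a product
measure whose constant is the ECPF (`measureReal_pattern_inter_rectangle`,
`sampledAtomLaw_pattern`).

Sampled weights are almost surely positive and such atoms are distinct, so atoms coincide exactly
when labels do (`labelEvent_ae_eq`). This yields the joint law of labels and cluster atoms; the
observations are attached through `κ`. Taking every side to be `Ω` identifies the law of `m`, and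
dividing by it gives the EPPF. -/

theorem measurableEq_of_countablySeparated (Ω : Type*) [MeasurableSpace Ω]
    [MeasurableSpace.CountablySeparated Ω] : MeasurableEq Ω := by
  obtain ⟨f, hf, hinj⟩ := MeasurableSpace.measurable_injection_nat_bool_of_countablySeparated Ω
  refine ⟨?_⟩
  have h : Set.diagonal Ω = ⋂ n, {p : Ω × Ω | f p.1 n = f p.2 n} := by
    ext ⟨a, b⟩
    simp only [Set.mem_diagonal_iff, Set.mem_iInter, Set.mem_ofPred_eq]
    exact ⟨fun h n => by rw [h], fun h => hinj (funext h)⟩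
  rw [h]
  refine MeasurableSet.iInter fun n => measurableSet_eq_fun ?_ ?_
  · exact (measurable_pi_apply n).comp (hf.comp measurable_fst)
  · exact (measurable_pi_apply n).comp (hf.comp measurable_snd)

/-- Coordinates of a product of measures without atoms are almost surely distinct. -/
theorem ae_injective_pi {Ω : Type*} [MeasurableSpace Ω] [MeasurableEq Ω] (μ : Measure Ω)
    [IsFiniteMeasure μ] [NullSingletonClass μ] (l : ℕ) :
    ∀ᵐ v ∂(Measure.pi fun _ : Fin l => μ), Function.Injective v := by
  have key : ∀ j k : Fin l, j ≠ k → ∀ᵐ v ∂(Measure.pi fun _ : Fin l => μ), v j ≠ v k := by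
    intro j k hjk
    cases l with
    | zero => exact j.elim0
    | succ l =>
      -- Split off coordinate `j`; by Fubini the diagonal has slices that are single points, hence
      -- null.
      obtain ⟨i, hi⟩ := Fin.exists_succAbove_eq hjk.symm
      have hmp := measurePreserving_piFinSuccAbove (fun _ : Fin (l + 1) => μ) j
      have hset : MeasurableSet {p : Ω × (Fin l → Ω) | p.1 = p.2 i} :=
        measurableSet_eq_fun measurable_fst ((measurable_pi_apply i).comp measurable_snd)
      have h0 : (μ.prod (Measure.pi fun _ : Fin l => μ)) {p : Ω × (Fin l → Ω) | p.1 = p.2 i}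
          = 0 := by
        rw [Measure.prod_apply_symm hset]
        simp only [Set.preimage_ofPred_eq, Set.ofPred_eq_eq_singleton, measure_singleton,
          lintegral_zero]
      have h1 := hmp.measure_preimage hset.nullMeasurableSet
      rw [h0] at h1
      rw [ae_iff]
      refine measure_mono_null (fun v hv => ?_) h1
      simp only [ne_eq, not_not, Set.mem_ofPred_eq] at hv
      simp only [Set.mem_preimage, Set.mem_ofPred_eq, MeasurableEquiv.piFinSuccAbove_apply,
        Fin.insertNthEquiv_symm_apply]
      simpa [Fin.removeNth, hi] using hv
  have : ∀ᵐ v ∂(Measure.pi fun _ : Fin l => μ), ∀ j k : Fin l, j ≠ k → v j ≠ v k := by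
    simp only [eventually_all]
    exact fun j k h => key j k h
  filter_upwards [this] with v hv j k h
  by_contra hne
  exact hv j k hne h

/-- The first `N` coordinates of `f x`. -/
def cell {Ω : Type*} (f : Ω → ℕ → Bool) (N : ℕ) (x : Ω) : Fin N → Bool := fun i => f x i

theorem measurable_cell {Ω : Type*} [MeasurableSpace Ω] {f : Ω → ℕ → Bool} (hf : Measurable f)
    (N : ℕ) : Measurable (cell f N) :=
  measurable_pi_lambda _ fun i => (measurable_pi_apply (i : ℕ)).comp hf

theorem cell_eq_of_le {Ω : Type*} {f : Ω → ℕ → Bool} {N N' : ℕ} (h : N ≤ N') {x y : Ω}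
    (hxy : cell f N' x = cell f N' y) : cell f N x = cell f N y := by
  funext i
  exact congrFun hxy ⟨i, i.2.trans_le h⟩

theorem eventually_cell_eq_iff {Ω : Type*} {f : Ω → ℕ → Bool} (hf : Function.Injective f)
    (x y : Ω) : ∀ᶠ N in atTop, (cell f N x = cell f N y ↔ x = y) := by
  by_cases h : x = y
  · simp [h]
  · obtain ⟨n, hn⟩ : ∃ n, f x n ≠ f y n := by
      by_contra! hc
      exact h (hf (funext hc))
    filter_upwards [eventually_ge_atTop (n + 1)] with N hN
    simp only [h, iff_false]
    intro hc
    exact hn (congrFun hc ⟨n, hN⟩)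

/-- The cells around `x` decrease to `{x}` because `f` is injective, and `{x}` is null; continuity
from above concludes. -/
theorem tendsto_measureReal_inter_cell {Ω : Type*} [MeasurableSpace Ω] {f : Ω → ℕ → Bool}
    (hf : Measurable f) (hinj : Function.Injective f) (μ : Measure Ω) [IsFiniteMeasure μ]
    [NullSingletonClass μ] {A : Set Ω} (hA : MeasurableSet A) (x : Ω) :
    Tendsto (fun N => μ.real (A ∩ cell f N ⁻¹' {cell f N x})) atTop (𝓝 0) := by
  have hanti : Antitone fun N => A ∩ cell f N ⁻¹' {cell f N x} := by
    intro N N' h y hy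
    exact ⟨hy.1, cell_eq_of_le h hy.2⟩
  have h := tendsto_measure_iInter_atTop (μ := μ)
    (fun N => (hA.inter (measurable_cell hf N (measurableSet_singleton _))).nullMeasurableSet)
    hanti ⟨0, measure_ne_top _ _⟩
  have h0 : μ (⋂ N, A ∩ cell f N ⁻¹' {cell f N x}) = 0 := by
    refine measure_mono_null (t := {x}) (fun y hy => ?_) (measure_singleton x)
    rw [Set.mem_iInter] at hy
    obtain ⟨N, hN⟩ := (eventually_cell_eq_iff hinj y x).exists
    exact hN.1 (hy N).2
  rw [h0] at h
  exact (ENNReal.tendsto_toReal ENNReal.zero_ne_top).comp h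

/-- A measure on `Ωⁿ` that is of product form, with densities `pₖ(μ(Dₖ))`, on rectangles with
disjoint sides within each partition `q` of the coordinates, restricts to the set of points whose
pattern of coincidences is `q` as the product measure with densities `pₖ(0)`. -/
theorem measureReal_pattern_inter_rectangle {Ω ι : Type*} [MeasurableSpace Ω]
    [MeasurableSpace.CountablySeparated Ω] [Fintype ι] (μ : Measure Ω) [IsFiniteMeasure μ]
    [NullSingletonClass μ] (M : Measure (ι → Ω)) [IsFiniteMeasure M] {l : ℕ} (q : ι → Fin l)
    (hq : Function.Surjective q) (p : Fin l → ℝ → ℝ) (hp : ∀ k, Continuous (p k)) (K : ℝ)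
    (hM : ∀ D : Fin l → Set Ω, (∀ k, MeasurableSet (D k)) →
      Pairwise (fun j k => Disjoint (D j) (D k)) →
      M.real {w | ∀ i, w i ∈ D (q i)} = K * ∏ k, (μ.real (D k) * p k (μ.real (D k))))
    (A : Fin l → Set Ω) (hA : ∀ k, MeasurableSet (A k)) :
    M.real {w | (∀ i j, w i = w j ↔ q i = q j) ∧ ∀ i, w i ∈ A (q i)} =
      K * ∏ k, (μ.real (A k) * p k 0) := by
  classical
  have := measurableEq_of_countablySeparated Ω
  obtain ⟨f, hf, hinj⟩ := MeasurableSpace.measurable_injection_nat_bool_of_countablySeparated Ω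
  set D : ∀ N, (Fin l → Fin N → Bool) → Fin l → Set Ω :=
    fun N c k => A k ∩ cell f N ⁻¹' {c k} with hD
  have hDm : ∀ N c k, MeasurableSet (D N c k) := fun N c k =>
    (hA k).inter (measurable_cell hf N (measurableSet_singleton _))
  -- The pattern of coincidences seen at resolution `N`: equality of points is replaced by equality
  -- of cells.
  set E : ℕ → Set (ι → Ω) := fun N =>
    {w | (∀ i j, cell f N (w i) = cell f N (w j) ↔ q i = q j) ∧ ∀ i, w i ∈ A (q i)} with hE
  -- Chosen so that `K ∫ F N` reproduces the product formula `hM` summed over injective choices of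
  -- cells. At a given `v` at most one choice `c` contributes.
  set F : ℕ → (Fin l → Ω) → ℝ := fun N v =>
    ∑ c : Fin l → Fin N → Bool with Function.Injective c,
      ∏ k, (D N c k).indicator (fun _ => p k (μ.real (D N c k))) (v k) with hF
  -- the cell approximation
  have hEU : ∀ N, E N = ⋃ c ∈ (Finset.univ.filter Function.Injective :
      Finset (Fin l → Fin N → Bool)), {w | ∀ i, w i ∈ D N c (q i)} := by
    intro N
    ext w
    simp only [hE, hD, Set.mem_ofPred_eq, Finset.mem_filter, Finset.mem_univ, true_and,
      Set.mem_iUnion, exists_prop, Set.mem_inter_iff, Set.mem_preimage, Set.mem_singleton_iff]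
    constructor
    · rintro ⟨h1, h2⟩
      refine ⟨fun k => cell f N (w (Function.surjInv hq k)), ?_, ?_⟩
      · intro j k hjk
        have := (h1 _ _).1 hjk
        rwa [Function.surjInv_eq hq, Function.surjInv_eq hq] at this
      · intro i
        refine ⟨h2 i, (h1 _ _).2 ?_⟩
        rw [Function.surjInv_eq hq]
    · rintro ⟨c, hc, h⟩
      refine ⟨fun i j => ?_, fun i => (h i).1⟩
      rw [(h i).2, (h j).2]
      exact hc.eq_iff
  have hEm : ∀ N, MeasurableSet (E N) := by
    intro N
    rw [hEU N]
    refine Finset.measurableSet_biUnion _ fun c _ => ?_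
    rw [Set.ofPred_forall]
    exact MeasurableSet.iInter fun i => measurable_pi_apply i (hDm N c (q i))
  have hMF : ∀ N, M.real (E N) = K * ∫ v, F N v ∂(Measure.pi fun _ : Fin l => μ) := by
    intro N
    rw [hEU N, measureReal_biUnion_finset]
    · rw [hF, integral_finsetSum, Finset.mul_sum]
      · refine Finset.sum_congr rfl fun c hc => ?_
        rw [integral_fintype_prod_eq_prod (fun k => (D N c k).indicator
          (fun _ => p k (μ.real (D N c k)))), hM (D N c) (hDm N c)]
        · congr 1
          refine Finset.prod_congr rfl fun k _ => ?_
          rw [integral_indicator (hDm N c k), setIntegral_const, smul_eq_mul]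
        · intro j k hjk
          rw [Set.disjoint_left]
          intro x hx hx'
          exact hjk ((Finset.mem_filter.1 hc).2 (hx.2.symm.trans hx'.2))
      · intro c _
        refine Integrable.fintype_prod (f := fun k => (D N c k).indicator
          (fun _ => p k (μ.real (D N c k)))) fun k => ?_
        exact (integrable_const _).indicator (hDm N c k)
    · intro c _ c' _ hcc'
      rw [Function.onFun, Set.disjoint_left]
      intro w hw hw'
      refine hcc' (funext fun k => ?_)
      obtain ⟨i, rfl⟩ := hq k
      exact (hw i).2.symm.trans (hw' i).2
    · intro c _
      rw [Set.ofPred_forall]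
      exact MeasurableSet.iInter fun i => measurable_pi_apply i (hDm N c (q i))
  have hFval : ∀ N v, F N v = if Function.Injective (fun k => cell f N (v k)) then
      ∏ k, (A k).indicator (fun _ =>
        p k (μ.real (A k ∩ cell f N ⁻¹' {cell f N (v k)}))) (v k) else 0 := by
    intro N v
    rw [hF]
    dsimp only
    have hz : ∀ c : Fin l → Fin N → Bool, c ≠ (fun k => cell f N (v k)) →
        ∏ k, (D N c k).indicator (fun _ => p k (μ.real (D N c k))) (v k) = 0 := by
      intro c hc
      obtain ⟨k, hk⟩ := Function.ne_iff.1 hc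
      refine Finset.prod_eq_zero (Finset.mem_univ k) (Set.indicator_of_notMem ?_ _)
      exact fun h => hk h.2.symm
    split_ifs with h
    · rw [Finset.sum_eq_single (fun k => cell f N (v k))]
      · refine Finset.prod_congr rfl fun k _ => ?_
        simp [hD, Set.indicator_apply]
      · exact fun c _ hc => hz c hc
      · intro hc
        simp [h] at hc
    · refine Finset.sum_eq_zero fun c hc => hz c fun hc' => h ?_
      rw [← hc']
      exact (Finset.mem_filter.1 hc).2
  -- limits of both sides
  have hlimE : Tendsto (fun N => M.real (E N)) atTop
      (𝓝 (M.real {w | (∀ i j, w i = w j ↔ q i = q j) ∧ ∀ i, w i ∈ A (q i)})) := by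
    refine (ENNReal.tendsto_toReal (measure_ne_top _ _)).comp ?_
    refine tendsto_measure_of_ae_tendsto_indicator_of_isFiniteMeasure atTop ?_ hEm ?_
    · rw [Set.ofPred_and, Set.ofPred_forall, Set.ofPred_forall]
      refine MeasurableSet.inter (MeasurableSet.iInter fun i => ?_)
        (MeasurableSet.iInter fun i => measurable_pi_apply i (hA _))
      rw [Set.ofPred_forall]
      refine MeasurableSet.iInter fun j => ?_
      have := measurableSet_eq_fun (measurable_pi_apply (X := fun _ : ι => Ω) i)
        (measurable_pi_apply j)
      by_cases h : q i = q j
      · simpa [h] using this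
      · simp only [h, iff_false]
        exact this.compl
    · refine Eventually.of_forall fun w => ?_
      have : ∀ᶠ N in atTop, ∀ i j, (cell f N (w i) = cell f N (w j) ↔ w i = w j) := by
        simp only [eventually_all]
        exact fun i j => eventually_cell_eq_iff hinj _ _
      filter_upwards [this] with N hN
      simp only [hE, Set.mem_ofPred_eq, hN]
  have hlimF : Tendsto (fun N => ∫ v, F N v ∂(Measure.pi fun _ : Fin l => μ)) atTop
      (𝓝 (∫ v, ∏ k, (A k).indicator (fun _ => p k 0) (v k) ∂(Measure.pi fun _ : Fin l => μ))) := by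
    -- The densities are evaluated only at masses in `[0, μ(Ω)]`, so compactness supplies a constant
    -- dominating function.
    have hbd : ∀ k, ∃ B, ∀ t ∈ Set.Icc 0 (μ.real Set.univ), ‖p k t‖ ≤ B := fun k =>
      isCompact_Icc.exists_bound_of_continuousOn (hp k).continuousOn
    choose B hB using hbd
    have hB0 : ∀ k, 0 ≤ B k := fun k =>
      (norm_nonneg _).trans (hB k 0 ⟨le_rfl, measureReal_nonneg⟩)
    refine tendsto_integral_of_dominated_convergence (fun _ => ∏ k, B k) ?_
      (integrable_const _) ?_ ?_
    · intro N
      refine Measurable.aestronglyMeasurable ?_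
      refine Finset.measurable_sum _ fun c _ => Finset.measurable_prod _ fun k _ => ?_
      exact (measurable_const.indicator (hDm N c k)).comp (measurable_pi_apply k)
    · refine fun N => Eventually.of_forall fun v => ?_
      rw [hFval]
      split_ifs
      · rw [norm_prod]
        refine Finset.prod_le_prod (fun _ _ => norm_nonneg _) fun k _ => ?_
        refine (norm_indicator_le_norm_self _ _).trans (hB k _ ⟨measureReal_nonneg, ?_⟩)
        exact measureReal_mono (Set.subset_univ _)
      · rw [norm_zero]
        exact Finset.prod_nonneg fun k _ => hB0 k
    -- At an injective `v` the cells eventually separate all coordinates, so the injectivity test in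
    -- `hFval` succeeds; the other `v` form a null set.
    · filter_upwards [ae_injective_pi μ l] with v hv
      have h1 : ∀ᶠ N in atTop, F N v = ∏ k, (A k).indicator (fun _ =>
          p k (μ.real (A k ∩ cell f N ⁻¹' {cell f N (v k)}))) (v k) := by
        have : ∀ᶠ N in atTop, ∀ i j, (cell f N (v i) = cell f N (v j) ↔ v i = v j) := by
          simp only [eventually_all]
          exact fun i j => eventually_cell_eq_iff hinj _ _
        filter_upwards [this] with N hN
        rw [hFval, if_pos (show Function.Injective (fun k => cell f N (v k)) from
          fun i j h => hv ((hN i j).1 h))]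
      refine Tendsto.congr' (EventuallyEq.symm h1) (tendsto_finsetProd _ fun k _ => ?_)
      by_cases hk : v k ∈ A k
      · simp only [Set.indicator_of_mem hk]
        exact ((hp k).tendsto 0).comp (tendsto_measureReal_inter_cell hf hinj μ (hA k) (v k))
      · simp only [Set.indicator_of_notMem hk]
        exact tendsto_const_nhds
  have h := tendsto_nhds_unique hlimE (Tendsto.congr (fun N => (hMF N).symm) (hlimF.const_mul K))
  rw [h, integral_fintype_prod_eq_prod (fun k => (A k).indicator (fun _ => p k 0))]
  congr 1
  refine Finset.prod_congr rfl fun k _ => ?_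
  rw [integral_indicator (hA k), setIntegral_const, smul_eq_mul]

/-! ### The Laplace exponent of a Lévy measure -/

theorem IsLevyMeasure.ae_pos {ρ : Measure ℝ} (hρ : IsLevyMeasure ρ) : ∀ᵐ r ∂ρ, 0 < r := by
  rw [ae_iff]
  simpa [Set.Iic] using hρ.nonpos_null

theorem IsLevyMeasure.integrable_min {ρ : Measure ℝ} (hρ : IsLevyMeasure ρ) :
    Integrable (fun r => min 1 r) ρ := by
  refine ⟨by fun_prop, ?_⟩
  rw [hasFiniteIntegral_iff_ofReal]
  · exact hρ.lintegral_min_lt_top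
  · filter_upwards [hρ.ae_pos] with r hr
    exact le_min zero_le_one hr.le

theorem IsLevyMeasure.integrable_of_le {ρ : Measure ℝ} (hρ : IsLevyMeasure ρ) {E : Type*}
    [NormedAddCommGroup E] {g : ℝ → E} (hg : AEStronglyMeasurable g ρ) (C : ℝ)
    (h : ∀ r, 0 < r → ‖g r‖ ≤ C * min 1 r) : Integrable g ρ := by
  refine (hρ.integrable_min.const_mul C).mono' hg ?_
  filter_upwards [hρ.ae_pos] with r hr using h r hr

theorem norm_cexp_sub_one_le {z : ℂ} (hz : z.re ≤ 0) :
    ‖Complex.exp z - 1‖ ≤ 2 * min 1 ‖z‖ := by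
  rcases le_total ‖z‖ 1 with h | h
  · rw [min_eq_right h]
    exact Complex.norm_exp_sub_one_le h
  · rw [min_eq_left h]
    refine (norm_sub_le _ _).trans ?_
    rw [Complex.norm_exp, norm_one]
    have := Real.exp_le_one_iff.2 hz
    linarith

theorem norm_cexp_mul_sub_one_le {w : ℂ} (hw : w.re ≤ 0) {r C : ℝ} (hr : 0 < r) (hC : 1 ≤ C)
    (hwC : ‖w‖ ≤ C) : ‖Complex.exp (w * r) - 1‖ ≤ 2 * C * min 1 r := by
  refine (norm_cexp_sub_one_le ?_).trans ?_
  · simpa using mul_nonpos_of_nonpos_of_nonneg hw hr.le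
  · rw [mul_assoc, mul_min_of_nonneg _ _ (by linarith : 0 ≤ C), mul_one, norm_mul,
      Complex.norm_real, Real.norm_of_nonneg hr.le]
    gcongr

theorem mul_exp_neg_mul_le {δ : ℝ} (hδ : 0 < δ) {r : ℝ} (hr : 0 < r) :
    r * Real.exp (-δ * r) ≤ (1 + δ⁻¹) * min 1 r := by
  have hδ' : 0 < δ⁻¹ := inv_pos.2 hδ
  rcases le_total r 1 with h | h
  · rw [min_eq_right h]
    have : Real.exp (-δ * r) ≤ 1 := Real.exp_le_one_iff.2 (by nlinarith)
    nlinarith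
  · rw [min_eq_left h, neg_mul, Real.exp_neg]
    have h1 : δ * r ≤ Real.exp (δ * r) := by linarith [Real.add_one_le_exp (δ * r)]
    have h2 : r ≤ δ⁻¹ * Real.exp (δ * r) := by
      rw [inv_mul_eq_div, le_div_iff₀ hδ]
      linarith
    have h3 : r * (Real.exp (δ * r))⁻¹ ≤ δ⁻¹ := by
      rw [← div_eq_mul_inv, div_le_iff₀ (Real.exp_pos _)]
      exact h2
    linarith

theorem IsLevyMeasure.integrable_cexp_sub_one {ρ : Measure ℝ} (hρ : IsLevyMeasure ρ) {w : ℂ}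
    (hw : w.re ≤ 0) : Integrable (fun r : ℝ => Complex.exp (w * r) - 1) ρ :=
  hρ.integrable_of_le (by fun_prop) (2 * (1 + ‖w‖)) fun _ hr =>
    norm_cexp_mul_sub_one_le hw hr (by simp) (by simp)

theorem IsLevyMeasure.integrable_mul_exp {ρ : Measure ℝ} (hρ : IsLevyMeasure ρ) {δ : ℝ}
    (hδ : 0 < δ) : Integrable (fun r : ℝ => r * Real.exp (-δ * r)) ρ := by
  refine hρ.integrable_of_le (by fun_prop) (1 + δ⁻¹) fun r hr => ?_
  rw [Real.norm_of_nonneg (by positivity)]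
  exact mul_exp_neg_mul_le hδ hr

/-- The Laplace exponent `∫ (e^{wr} - 1) ρ(dr)` of a Lévy measure. -/
def levyExponent (ρ : Measure ℝ) (w : ℂ) : ℂ := ∫ r : ℝ, (Complex.exp (w * r) - 1) ∂ρ

theorem levyExponent_ofReal (ρ : Measure ℝ) (t : ℝ) :
    levyExponent ρ t = ((∫ r, (Real.exp (t * r) - 1) ∂ρ : ℝ) : ℂ) := by
  rw [levyExponent, ← integral_complex_ofReal]
  simp

theorem hasDerivAt_levyExponent {ρ : Measure ℝ} (hρ : IsLevyMeasure ρ) {w : ℂ} (hw : w.re < 0) :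
    HasDerivAt (levyExponent ρ) (∫ r : ℝ, r * Complex.exp (w * r) ∂ρ) w := by
  -- On the half-plane `Re z < Re w / 2` the integrand's derivative is dominated by `r e^{(Re w / 2)
  -- r}`, uniformly in `z`.
  have hδ : 0 < -(w.re / 2) := by linarith
  have hs : {z : ℂ | z.re < w.re / 2} ∈ 𝓝 w :=
    (isOpen_lt Complex.continuous_re continuous_const).mem_nhds
      (show w.re < w.re / 2 by linarith)
  refine (hasDerivAt_integral_of_dominated_loc_of_deriv_le
    (F' := fun z (r : ℝ) => (r : ℂ) * Complex.exp (z * r))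
    (bound := fun r => r * Real.exp (-(-(w.re / 2)) * r)) hs
    (Eventually.of_forall fun z => by fun_prop) (hρ.integrable_cexp_sub_one hw.le) (by fun_prop)
    ?_ (hρ.integrable_mul_exp hδ) ?_).2
  · filter_upwards [hρ.ae_pos] with r hr z hz
    rw [norm_mul, Complex.norm_real, Real.norm_of_nonneg hr.le, Complex.norm_exp, neg_neg]
    replace hz : z.re < w.re / 2 := hz
    simp only [Complex.mul_re, Complex.ofReal_re, Complex.ofReal_im, mul_zero, sub_zero]
    gcongr
  · refine Eventually.of_forall fun r z _ => ?_
    have h1 : HasDerivAt (fun z : ℂ => z * (r : ℂ)) (r : ℂ) z := by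
      simpa using (hasDerivAt_id z).mul_const (r : ℂ)
    have h2 := h1.cexp.sub_const 1
    rwa [mul_comm] at h2

/-- The bound by a multiple of `min 1 r` holds up to the imaginary axis, where differentiability may
fail. The boundary is needed because that is where the characteristic function lives. -/
theorem continuousOn_levyExponent {ρ : Measure ℝ} (hρ : IsLevyMeasure ρ) :
    ContinuousOn (levyExponent ρ) {w | w.re ≤ 0} := by
  intro w _
  refine continuousWithinAt_of_dominated (bound := fun r => 2 * (‖w‖ + 1) * min 1 r)
    (Eventually.of_forall fun z => by fun_prop) ?_ (hρ.integrable_min.const_mul _) ?_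
  · have h1 : ∀ᶠ z in 𝓝[{w : ℂ | w.re ≤ 0}] w, ‖z‖ ≤ ‖w‖ + 1 :=
      (continuous_norm.tendsto w).mono_left nhdsWithin_le_nhds
        |>.eventually (eventually_le_nhds (by linarith))
    filter_upwards [h1, self_mem_nhdsWithin] with z hz hz'
    filter_upwards [hρ.ae_pos] with r hr
    exact norm_cexp_mul_sub_one_le hz' hr (by simp) hz
  · refine Eventually.of_forall fun r => ?_
    exact Continuous.continuousWithinAt (by fun_prop)

theorem levyExponent_re_nonpos {ρ : Measure ℝ} (hρ : IsLevyMeasure ρ) {w : ℂ} (hw : w.re ≤ 0) :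
    (levyExponent ρ w).re ≤ 0 := by
  rw [levyExponent, ← RCLike.re_eq_complex_re, ← integral_re (hρ.integrable_cexp_sub_one hw)]
  refine integral_nonpos_of_ae ?_
  filter_upwards [hρ.ae_pos] with r hr
  simp only [RCLike.re_eq_complex_re, Complex.sub_re, Complex.one_re, Pi.zero_apply]
  have h1 := Complex.re_le_norm (Complex.exp (w * r))
  rw [Complex.norm_exp] at h1
  have h2 : Real.exp (w * r).re ≤ 1 := by
    refine Real.exp_le_one_iff.2 ?_
    simpa using mul_nonpos_of_nonpos_of_nonneg hw hr.le
  linarith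

/-! ### From the characteristic function to the Laplace transform -/

theorem integrable_exp_mul_of_nonneg {S : Type*} [MeasurableSpace S] {P : Measure S}
    [IsProbabilityMeasure P] {X : S → ℝ} (hX : Measurable X) (hX0 : ∀ s, 0 ≤ X s) {t : ℝ}
    (ht : t ≤ 0) : Integrable (fun s => Real.exp (t * X s)) P := by
  refine Integrable.of_bound (C := 1) (by fun_prop) (Eventually.of_forall fun s => ?_)
  rw [Real.norm_of_nonneg (Real.exp_pos _).le]
  exact Real.exp_le_one_iff.2 (mul_nonpos_of_nonpos_of_nonneg ht (hX0 s))

theorem mem_interior_integrableExpSet {S : Type*} [MeasurableSpace S] {P : Measure S}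
    {X : S → ℝ} (h : ∀ t < 0, Integrable (fun s => Real.exp (t * X s)) P) {t : ℝ} (ht : t < 0) :
    t ∈ interior (integrableExpSet X P) :=
  interior_maximal (fun u hu => h u hu) isOpen_Iio ht

theorem norm_cexp_mul_le_one {w : ℂ} (hw : w.re ≤ 0) {x : ℝ} (hx : 0 ≤ x) :
    ‖Complex.exp (w * x)‖ ≤ 1 := by
  rw [Complex.norm_exp]
  refine Real.exp_le_one_iff.2 ?_
  simpa using mul_nonpos_of_nonpos_of_nonneg hw hx

/-- A nonnegative random variable whose characteristic function has Lévy exponent `a ρ` has the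
corresponding Laplace transform. -/
theorem mgf_eq_exp_levyExponent {S : Type*} [MeasurableSpace S] {P : Measure S}
    [IsProbabilityMeasure P] {X : S → ℝ} (hX : Measurable X) (hX0 : ∀ s, 0 ≤ X s)
    {ρ : Measure ℝ} (hρ : IsLevyMeasure ρ) {a : ℝ} (ha : 0 ≤ a)
    (h : ∀ u : ℝ, ∫ s, Complex.exp (Complex.I * u * X s) ∂P =
      Complex.exp (a * levyExponent ρ (Complex.I * u))) {t : ℝ} (ht : t ≤ 0) :
    mgf X P t = Real.exp (a * ∫ r, (Real.exp (t * r) - 1) ∂ρ) := by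
  -- The sign change moves the problem to the right half-plane, where `f` is holomorphic inside,
  -- bounded by 2, and zero on the imaginary axis by `h`.
  set f : ℂ → ℂ := fun w => complexMGF X P (-w) - Complex.exp (a * levyExponent ρ (-w)) with hf
  have hclos : closure {z : ℂ | 0 < z.re} = {z : ℂ | 0 ≤ z.re}  :=
    Complex.closure_setOfPred_lt_re 0
  have hneg : Set.MapsTo (fun w : ℂ => -w) {z | 0 ≤ z.re} {z | z.re ≤ 0} := by
    intro z hz
    simpa using hz
  have hd : DiffContOnCl ℂ f {z | 0 < z.re} := by
    constructor
    · intro w hw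
      have hw' : (-w).re < 0 := by simpa using hw
      have h1 : HasDerivAt (complexMGF X P) _ (-w) := hasDerivAt_complexMGF
        (mem_interior_integrableExpSet (fun t ht => integrable_exp_mul_of_nonneg hX hX0 ht.le) hw')
      have h2 := ((hasDerivAt_levyExponent hρ hw').const_mul (a : ℂ)).cexp
      exact ((h1.comp w (hasDerivAt_neg w)).sub
        (h2.comp w (hasDerivAt_neg w))).differentiableAt.differentiableWithinAt
    · rw [hclos]
      refine ContinuousOn.sub ?_ ?_
      · have : ContinuousOn (complexMGF X P) {z | z.re ≤ 0} := by
          intro w hw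
          refine continuousWithinAt_of_dominated (bound := fun _ => 1)
            (Eventually.of_forall fun z => by fun_prop) ?_ (integrable_const _)
            (Eventually.of_forall fun s => Continuous.continuousWithinAt (by fun_prop))
          filter_upwards [self_mem_nhdsWithin] with z hz
          exact Eventually.of_forall fun s => norm_cexp_mul_le_one hz (hX0 s)
        exact this.comp continuous_neg.continuousOn hneg
      · exact (((continuousOn_levyExponent hρ).comp continuous_neg.continuousOn hneg).const_smul
          (a : ℂ)).cexp
  have hbd : ∀ w : ℂ, 0 ≤ w.re → ‖f w‖ ≤ 2 := by
    intro w hw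
    have hw' : (-w).re ≤ 0 := by simpa using hw
    have h1 : ‖complexMGF X P (-w)‖ ≤ 1 := by
      have := norm_integral_le_of_norm_le_const (μ := P) (C := 1)
        (f := fun s => Complex.exp (-w * X s))
        (Eventually.of_forall fun s => norm_cexp_mul_le_one hw' (hX0 s))
      simpa [complexMGF] using this
    have h2 : ‖Complex.exp (a * levyExponent ρ (-w))‖ ≤ 1 := by
      rw [Complex.norm_exp]
      refine Real.exp_le_one_iff.2 ?_
      simpa using mul_nonpos_of_nonneg_of_nonpos ha (levyExponent_re_nonpos hρ hw')
    calc ‖f w‖ ≤ _ := norm_sub_le _ _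
      _ ≤ 2 := by linarith
  have key : ‖f ((-t : ℝ) : ℂ)‖ ≤ 0 := by
    -- Growth exponent 1 (below the critical 2) with coefficient 0 just says that `f` is bounded;
    -- the boundary bound 0 then propagates inside.
    refine PhragmenLindelof.right_half_plane_of_bounded_on_real hd
      ⟨1, by norm_num, 0, ?_⟩ ?_ ?_ ?_
    · refine Asymptotics.IsBigO.of_bound 2 ?_
      refine eventually_inf_principal.2 (Eventually.of_forall fun z hz => ?_)
      simpa using hbd z (le_of_lt hz)
    · refine ⟨2, ?_⟩
      rw [eventually_map]
      filter_upwards [eventually_ge_atTop 0] with x hx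
      exact hbd x (by simpa using hx)
    · intro x
      have hx := h (-x)
      rw [norm_le_zero_iff, hf]
      dsimp only
      have e : -(x * Complex.I) = Complex.I * ((-x : ℝ) : ℂ) := by push_cast; ring
      rw [e, ← hx, complexMGF, sub_self]
    · simpa using ht
  rw [norm_le_zero_iff, hf] at key
  dsimp only at key
  rw [← Complex.ofReal_neg, neg_neg, levyExponent_ofReal, complexMGF_ofReal, sub_eq_zero] at key
  exact_mod_cast key

/-! ### Exponentially tilted moments -/

/-- The tilted moments of `ρ`. -/
def levyMoment (ρ : Measure ℝ) (n : ℕ) : ℝ := ∫ r, r ^ n * Real.exp (-r) ∂ρ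

/-- The polynomials `Qₙ` with `E[Xⁿ e^{-X}] = Qₙ(a) E[e^{-X}]` for a random variable `X` with Lévy
measure `a ρ` whose tilted moments are `a c₁, a c₂, …`. -/
def tiltedMoment (c : ℕ → ℝ) : ℕ → ℝ → ℝ
  | 0, _ => 1
  | n + 1, a => a * ∑ i : Fin (n + 1), (n.choose i) * c (n - i + 1) * tiltedMoment c i a

/-- The polynomial `Qₙ(a) / a`, for `n ≥ 1`. -/
def tiltedMomentQuotient (c : ℕ → ℝ) (n : ℕ) (a : ℝ) : ℝ :=
  ∑ i : Fin n, ((n - 1).choose i) * c (n - 1 - i + 1) * tiltedMoment c i a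

theorem tiltedMoment_eq_mul_quotient (c : ℕ → ℝ) {n : ℕ} (hn : n ≠ 0) (a : ℝ) :
    tiltedMoment c n a = a * tiltedMomentQuotient c n a := by
  obtain ⟨n, rfl⟩ := Nat.exists_eq_succ_of_ne_zero hn
  rw [Nat.succ_eq_add_one, tiltedMoment, tiltedMomentQuotient]
  simp

theorem continuous_tiltedMoment (c : ℕ → ℝ) (n : ℕ) : Continuous (tiltedMoment c n) := by
  induction n using Nat.strong_induction_on with
  | _ n ih =>
    cases n with
    | zero =>
      rw [show tiltedMoment c 0 = fun _ => 1 from funext fun a => by rw [tiltedMoment]]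
      exact continuous_const
    | succ n =>
      rw [show tiltedMoment c (n + 1) = fun a => a * ∑ i : Fin (n + 1),
        (n.choose i) * c (n - i + 1) * tiltedMoment c i a from funext fun a => by rw [tiltedMoment]]
      exact continuous_id.mul (continuous_finsetSum _ fun i _ =>
        continuous_const.mul (ih i i.2))

theorem continuous_tiltedMomentQuotient (c : ℕ → ℝ) (n : ℕ) :
    Continuous (tiltedMomentQuotient c n) :=
  continuous_finsetSum _ fun i _ => continuous_const.mul (continuous_tiltedMoment c i)

/-- Every `Qᵢ` with `i ≥ 1` carries a factor `a`, so only the term `i = 0` survives. The recursion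
never uses `c 0`, which matters because `∫ e⁻ʳ ρ(dr)` may diverge. -/
theorem tiltedMomentQuotient_zero (c : ℕ → ℝ) {n : ℕ} (hn : n ≠ 0) :
    tiltedMomentQuotient c n 0 = c n := by
  obtain ⟨n, rfl⟩ := Nat.exists_eq_succ_of_ne_zero hn
  rw [tiltedMomentQuotient, Finset.sum_eq_single (0 : Fin (n + 1))]
  · simp [tiltedMoment]
  · intro i _ hi
    have : (i : ℕ) ≠ 0 := fun h => hi (Fin.ext h)
    rw [tiltedMoment_eq_mul_quotient c this]
    simp
  · simp

/-- The measure `r ρ(dr)` may be infinite, but its moment generating function is finite on the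
negative axis. Writing the derivative of the Laplace exponent as this function gives all higher
derivatives at once. -/
theorem mgf_sizeBiased {ρ : Measure ℝ} (hρ : IsLevyMeasure ρ) :
    (∀ t < 0, Integrable (fun r => Real.exp (t * id r))
      (ρ.withDensity fun r => ENNReal.ofReal r)) ∧
    (∀ n : ℕ, ∀ t : ℝ, ∫ r, r ^ n * Real.exp (t * r) ∂(ρ.withDensity fun r => ENNReal.ofReal r) =
      ∫ r, r ^ (n + 1) * Real.exp (t * r) ∂ρ) := by
  constructor
  · intro t ht
    rw [integrable_withDensity_iff_integrable_smul' (by fun_prop) (by simp)]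
    refine (hρ.integrable_mul_exp (δ := -t) (by linarith)).congr ?_
    filter_upwards [hρ.ae_pos] with r hr
    simp [ENNReal.toReal_ofReal hr.le]
  · intro n t
    rw [integral_withDensity_eq_integral_toReal_smul (by fun_prop) (by simp)]
    refine integral_congr_ae ?_
    filter_upwards [hρ.ae_pos] with r hr
    simp only [ENNReal.toReal_ofReal hr.le, smul_eq_mul]
    ring

theorem hasDerivAt_levyExponent_real {ρ : Measure ℝ} (hρ : IsLevyMeasure ρ) {t : ℝ}
    (ht : t < 0) : HasDerivAt (fun t : ℝ => ∫ r, (Real.exp (t * r) - 1) ∂ρ)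
      (mgf id (ρ.withDensity fun r => ENNReal.ofReal r) t) t := by
  have h := (hasDerivAt_levyExponent hρ (w := t) (by simpa using ht)).real_of_complex
  have e1 : (fun x : ℝ => (levyExponent ρ x).re) =
      fun t : ℝ => ∫ r, (Real.exp (t * r) - 1) ∂ρ := by
    funext x
    rw [levyExponent_ofReal, Complex.ofReal_re]
  have e2 : (∫ r : ℝ, (r : ℂ) * Complex.exp (t * r) ∂ρ) =
      ((∫ r, r * Real.exp (t * r) ∂ρ : ℝ) : ℂ) := by
    rw [← integral_complex_ofReal]
    simp
  rw [e1, e2, Complex.ofReal_re] at h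
  have h2 := (mgf_sizeBiased hρ).2 0 t
  simp only [pow_zero, one_mul, zero_add, pow_one] at h2
  rw [← h2] at h
  exact h

/-- The tilted moments of a random variable with Lévy measure `a ρ`. -/
theorem integral_pow_mul_exp_neg {S : Type*} [MeasurableSpace S] {P : Measure S}
    [IsProbabilityMeasure P] {X : S → ℝ} (hX : Measurable X) (hX0 : ∀ s, 0 ≤ X s)
    {ρ : Measure ℝ} (hρ : IsLevyMeasure ρ) {a : ℝ}
    (h : ∀ t ≤ 0, mgf X P t = Real.exp (a * ∫ r, (Real.exp (t * r) - 1) ∂ρ)) (n : ℕ) :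
    ∫ s, X s ^ n * Real.exp (-X s) ∂P =
      tiltedMoment (levyMoment ρ) n a * Real.exp (a * ∫ r, (Real.exp (-r) - 1) ∂ρ) := by
  set ν := ρ.withDensity fun r => ENNReal.ofReal r with hν
  have hXi : ∀ {t : ℝ}, t < 0 → t ∈ interior (integrableExpSet X P) := fun ht =>
    mem_interior_integrableExpSet (fun t ht => integrable_exp_mul_of_nonneg hX hX0 ht.le) ht
  have hνi : ∀ {t : ℝ}, t < 0 → t ∈ interior (integrableExpSet id ν) := fun ht =>
    mem_interior_integrableExpSet (mgf_sizeBiased hρ).1 ht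
  -- The equation `φ' = a φ L`, with `L` the transform of `r ρ(dr)`; the Leibniz rule applied to it
  -- at `-1` is the recursion defining `tiltedMoment`.
  have hderiv : deriv (mgf X P) =ᶠ[𝓝 (-1)] fun t => a * (mgf X P t * mgf id ν t) := by
    filter_upwards [isOpen_Iio.mem_nhds (show (-1 : ℝ) ∈ Set.Iio 0 by norm_num)] with t ht
    have h1 := ((hasDerivAt_levyExponent_real hρ ht).const_mul a).exp
    have h2 : mgf X P =ᶠ[𝓝 t] fun t => Real.exp (a * ∫ r, (Real.exp (t * r) - 1) ∂ρ) := by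
      filter_upwards [isOpen_Iio.mem_nhds ht] with u hu using h u (le_of_lt hu)
    rw [h2.deriv_eq, h1.deriv, h t (le_of_lt ht)]
    ring
  have hX1 := hXi (show (-1 : ℝ) < 0 by norm_num)
  have hν1 := hνi (show (-1 : ℝ) < 0 by norm_num)
  have hmom : ∀ n, iteratedDeriv n (mgf X P) (-1) = ∫ s, X s ^ n * Real.exp (-X s) ∂P := by
    intro n
    rw [iteratedDeriv_mgf hX1]
    simp
  have hνmom : ∀ n, iteratedDeriv n (mgf id ν) (-1) = levyMoment ρ (n + 1) := by
    intro n
    rw [iteratedDeriv_mgf hν1]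
    simpa [levyMoment] using (mgf_sizeBiased hρ).2 n (-1)
  rw [← hmom]
  induction n using Nat.strong_induction_on with
  | _ n ih =>
    cases n with
    | zero => simpa [tiltedMoment] using h (-1) (by norm_num)
    | succ n =>
      rw [iteratedDeriv_succ', (hderiv.iteratedDeriv n).eq_of_nhds, iteratedDeriv_const_mul_field,
        iteratedDeriv_fun_mul (analyticAt_mgf hX1).contDiffAt (analyticAt_mgf hν1).contDiffAt,
        tiltedMoment, mul_assoc, Finset.sum_mul, ← Fin.sum_univ_eq_sum_range
          (fun i => (n.choose i : ℝ) * iteratedDeriv i (mgf X P) (-1) *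
            iteratedDeriv (n - i) (mgf id ν) (-1))]
      congr 1
      refine Finset.sum_congr rfl fun i _ => ?_
      rw [ih i i.2, hνmom]
      ring

section

/-! ### The law of the sampled atoms -/

/-- Distributivity for infinite sums: it turns the sum over label sequences into a product of values
of `G`. -/
theorem tsum_pi_prod_eq_prod_tsum (n : ℕ) (a : Fin n → ℕ → ℝ≥0∞) :
    ∑' y : Fin n → ℕ, ∏ i, a i (y i) = ∏ i, ∑' k, a i k := by
  induction n with
  | zero => simp
  | succ n ih =>
    rw [← (Fin.consEquiv fun _ : Fin (n + 1) => ℕ).tsum_eq, ENNReal.tsum_prod', Fin.prod_univ_succ,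
      ← ih, ← ENNReal.tsum_mul_right]
    refine tsum_congr fun k => ?_
    rw [← ENNReal.tsum_mul_left]
    refine tsum_congr fun y => ?_
    simp [Fin.prod_univ_succ, Fin.consEquiv]

theorem atomicMeasure_apply {Ω : Type*} [MeasurableSpace Ω] (r : ℕ → ℝ≥0) (ω : ℕ → Ω) {A : Set Ω}
    (hA : MeasurableSet A) :
    atomicMeasure r ω A = ∑' k, (r k : ℝ≥0∞) * A.indicator 1 (ω k) := by
  rw [atomicMeasure, Measure.sum_apply _ hA]
  refine tsum_congr fun k => ?_
  rw [Measure.smul_apply, Measure.dirac_apply' _ hA, smul_eq_mul]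

theorem atomicMeasure_univ {Ω : Type*} [MeasurableSpace Ω] (r : ℕ → ℝ≥0) (ω : ℕ → Ω) :
    atomicMeasure r ω Set.univ = ∑' k, (r k : ℝ≥0∞) := by
  simp [atomicMeasure_apply r ω MeasurableSet.univ]

theorem size_eq_iUnion {S : Type*} (m : S → ℕ) (z : ℕ → S → ℕ) (n : ℕ) :
    {s | m s = n} = ⋃ y : Fin n → ℕ, {s | m s = n ∧ ∀ i : Fin n, z i s = y i} := by
  ext s
  simp only [Set.mem_ofPred_eq, Set.mem_iUnion, exists_and_left, iff_self_and]
  exact fun _ => ⟨fun i => z i s, fun _ => rfl⟩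

theorem pairwise_disjoint_size_label {S : Type*} (m : S → ℕ) (z : ℕ → S → ℕ) (n : ℕ) :
    Pairwise (Function.onFun Disjoint
    fun y : Fin n → ℕ => {s | m s = n ∧ ∀ i : Fin n, z i s = y i}) := by
  intro y y' hy
  rw [Function.onFun, Set.disjoint_left]
  exact fun s hs hs' => hy (funext fun i => (hs.2 i).symm.trans (hs'.2 i))

/-- The factor `Tⁿ` of the Poisson mass cancels the normalisations `1 / T`. If `T = 0`, all weights
vanish and both sides agree; summability keeps `T` from being a default value. -/
theorem likelihood_eq {r : ℕ → ℝ≥0} (hr : Summable r) {n : ℕ} (y : Fin n → ℕ) :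
    likelihood r y = ENNReal.ofReal (Real.exp (-(∑' k, r k : ℝ≥0)) / n.factorial) *
      ∏ i, (r (y i) : ℝ≥0∞) := by
  rw [likelihood, poissonMeasure_singleton]
  set T : ℝ≥0 := ∑' k, r k with hT
  have h1 : ∏ i, ((r (y i) / T : ℝ≥0) : ℝ≥0∞) * (T : ℝ≥0∞) = ∏ i, (r (y i) : ℝ≥0∞) := by
    refine Finset.prod_congr rfl fun i _ => ?_
    rw [← ENNReal.coe_mul, div_mul_cancel_of_imp]
    intro h0
    exact (hr.tsum_eq_zero_iff.1 h0) (y i)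
  rw [Finset.prod_mul_distrib, Finset.prod_const, Finset.card_univ, Fintype.card_fin] at h1
  rw [← h1, mul_div_right_comm, ENNReal.ofReal_mul (by positivity), ← NNReal.coe_pow,
    ENNReal.ofReal_coe_nnreal, ENNReal.coe_pow]
  ring

variable {S Ω X : Type*} [MeasurableSpace S] [MeasurableSpace Ω] [MeasurableSpace X]
  {P : Measure S} {ρ : Measure ℝ} {G₀ : Measure Ω} {κ : Kernel Ω X}
  {r : ℕ → S → ℝ≥0} {ω : ℕ → S → Ω} {m : S → ℕ} {z : ℕ → S → ℕ} {x : ℕ → S → X}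

/-- The law of the atoms sampled by a sample of size `n`, on the event that the sample size
is `n`. -/
def sampledAtomLaw (P : Measure S) (ω : ℕ → S → Ω) (m : S → ℕ) (z : ℕ → S → ℕ) (n : ℕ) :
    Measure (Fin n → Ω) :=
  (P.restrict {s | m s = n}).map fun s i => ω (z i s) s

namespace IsCountMixture

theorem measurable_sampledAtom (h : IsCountMixture P ρ G₀ κ r ω m z x) (i : ℕ) :
    Measurable fun s => ω (z i s) s := by
  have h1 : Measurable fun p : ℕ × S => ω p.1 p.2 :=
    measurable_from_prod_countable_right fun k => h.measurable_atom k
  exact h1.comp ((h.measurable_label i).prodMk measurable_id)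

theorem measurable_sampledAtoms (h : IsCountMixture P ρ G₀ κ r ω m z x) (n : ℕ) :
    Measurable fun (s : S) (i : Fin n) => ω (z i s) s :=
  measurable_pi_lambda _ fun i => h.measurable_sampledAtom i

theorem measurable_atoms (h : IsCountMixture P ρ G₀ κ r ω m z x) :
    Measurable fun s => (⟨fun k => r k s, fun k => ω k s⟩ : (ℕ → ℝ≥0) × (ℕ → Ω)) :=
  (measurable_pi_lambda _ h.measurable_weight).prodMk (measurable_pi_lambda _ h.measurable_atom)

theorem measurableSet_size (h : IsCountMixture P ρ G₀ κ r ω m z x) (n : ℕ) :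
    MeasurableSet {s | m s = n} :=
  h.measurable_size (measurableSet_singleton n)

theorem measurableSet_size_label (h : IsCountMixture P ρ G₀ κ r ω m z x) (n : ℕ)
    (y : Fin n → ℕ) : MeasurableSet {s | m s = n ∧ ∀ i : Fin n, z i s = y i} := by
  rw [Set.ofPred_and, Set.ofPred_forall]
  refine (h.measurableSet_size n).inter ?_
  exact MeasurableSet.iInter fun i => h.measurable_label i (measurableSet_singleton _)

theorem ae_summable (h : IsCountMixture P ρ G₀ κ r ω m z x) :
    ∀ᵐ s ∂P, Summable fun k => r k s := by
  filter_upwards [h.completelyRandom.ae_finite] with s hs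
  rw [atomicMeasure_univ] at hs
  exact ENNReal.tsum_coe_ne_top_iff_summable.1 hs.ne

theorem measurable_likelihood {n : ℕ} (y : Fin n → ℕ) :
    Measurable fun p : (ℕ → ℝ≥0) × (ℕ → Ω) => likelihood p.1 y := by
  have hT : Measurable fun p : (ℕ → ℝ≥0) × (ℕ → Ω) => ∑' k, p.1 k :=
    Measurable.tsum fun k => by fun_prop
  simp only [likelihood, poissonMeasure_singleton]
  fun_prop

/-- The law of the weights and atoms on the event that the labels are `y`. -/
theorem setLIntegral_size_label (h : IsCountMixture P ρ G₀ κ r ω m z x) [IsMarkovKernel κ]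
    {n : ℕ} (y : Fin n → ℕ) {g : (ℕ → ℝ≥0) × (ℕ → Ω) → ℝ≥0∞} (hg : Measurable g) :
    ∫⁻ s in {s | m s = n ∧ ∀ i : Fin n, z i s = y i}, g (fun k => r k s, fun k => ω k s) ∂P =
      ∫⁻ s, likelihood (fun k => r k s) y * g (fun k => r k s, fun k => ω k s) ∂P := by
  have hlik := (measurable_likelihood y).comp h.measurable_atoms
  have key : (P.restrict {s | m s = n ∧ ∀ i : Fin n, z i s = y i}).map
      (fun s => (fun k => r k s, fun k => ω k s)) =
      (P.withDensity fun s => likelihood (fun k => r k s) y).map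
        (fun s => (fun k => r k s, fun k => ω k s)) := by
    ext A hA
    rw [Measure.map_apply h.measurable_atoms hA, Measure.map_apply h.measurable_atoms hA,
      withDensity_apply _ (h.measurable_atoms hA), Measure.restrict_apply (h.measurable_atoms hA)]
    have := h.conditional_law n y (fun _ => Set.univ) (fun _ => MeasurableSet.univ) A hA
    simp only [Set.mem_univ, implies_true, and_true, measure_univ, Finset.prod_const_one,
      mul_one] at this
    exact this
  have h1 : ∫⁻ p, g p ∂_ = ∫⁻ p, g p ∂_ := congrArg (fun μ => ∫⁻ p, g p ∂μ) key
  rw [lintegral_map hg h.measurable_atoms, lintegral_map hg h.measurable_atoms] at h1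
  exact h1.trans (lintegral_withDensity_eq_lintegral_mul P hlik (hg.comp h.measurable_atoms))

theorem measurableSet_atoms_mem {n : ℕ} (y : Fin n → ℕ) {C : Set (Fin n → Ω)}
    (hC : MeasurableSet C) :
    MeasurableSet {p : (ℕ → ℝ≥0) × (ℕ → Ω) | (fun i => p.2 (y i)) ∈ C} :=
  (measurable_pi_lambda (fun (p : (ℕ → ℝ≥0) × (ℕ → Ω)) i => p.2 (y i))
    fun _ => by fun_prop) hC

theorem lintegral_sampledAtomLaw (h : IsCountMixture P ρ G₀ κ r ω m z x) {n : ℕ}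
    {g : (Fin n → Ω) → ℝ≥0∞} (hg : Measurable g) :
    ∫⁻ w, g w ∂(sampledAtomLaw P ω m z n) =
      ∑' y : Fin n → ℕ, ∫⁻ s in {s | m s = n ∧ ∀ i : Fin n, z i s = y i},
        g (fun i => ω (y i) s) ∂P := by
  rw [sampledAtomLaw, lintegral_map hg (h.measurable_sampledAtoms n), size_eq_iUnion m z,
    lintegral_iUnion (fun y => h.measurableSet_size_label n y) (pairwise_disjoint_size_label m z n)]
  refine tsum_congr fun y => setLIntegral_congr_fun (h.measurableSet_size_label n y) ?_
  intro s hs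
  simp only [hs.2]

/-- Given the sampled atoms, the observations are independent with laws `κ(ω_{zᵢ})`. -/
theorem measure_sampledAtom_obs (h : IsCountMixture P ρ G₀ κ r ω m z x) [IsMarkovKernel κ]
    {n : ℕ} {C : Set (Fin n → Ω)} (hC : MeasurableSet C) {B : Fin n → Set X}
    (hB : ∀ i, MeasurableSet (B i)) :
    P {s | m s = n ∧ (fun i : Fin n => ω (z i s) s) ∈ C ∧ ∀ i : Fin n, x i s ∈ B i} =
      ∫⁻ w in C, ∏ i, κ (w i) (B i) ∂(sampledAtomLaw P ω m z n) := by
  have hκ : Measurable fun w : Fin n → Ω => ∏ i, κ (w i) (B i) :=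
    Finset.measurable_prod _ fun i _ => (κ.measurable_coe (hB i)).comp (measurable_pi_apply i)
  rw [← lintegral_indicator hC, h.lintegral_sampledAtomLaw (hκ.indicator hC)]
  have hx : MeasurableSet {s | ∀ i : Fin n, x i s ∈ B i} := by
    rw [Set.ofPred_forall]
    exact MeasurableSet.iInter fun i => h.measurable_obs i (hB i)
  -- Once the labels are fixed to `y`, the condition on sampled atoms becomes a condition on `(r,
  -- ω)` alone, to which `conditional_law` applies.
  have hset : {s | m s = n ∧ (fun i : Fin n => ω (z i s) s) ∈ C ∧ ∀ i : Fin n, x i s ∈ B i} =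
      ⋃ y : Fin n → ℕ, {s | (fun k => r k s, fun k => ω k s) ∈
        {p : (ℕ → ℝ≥0) × (ℕ → Ω) | (fun i => p.2 (y i)) ∈ C} ∧ m s = n ∧
          (∀ i : Fin n, z i s = y i) ∧ ∀ i : Fin n, x i s ∈ B i} := by
    ext s
    simp only [Set.mem_ofPred_eq, Set.mem_iUnion]
    constructor
    · rintro ⟨h1, h2, h3⟩
      exact ⟨fun i => z i s, h2, h1, fun _ => rfl, h3⟩
    · rintro ⟨y, h2, h1, h4, h3⟩
      exact ⟨h1, by simpa only [h4] using h2, h3⟩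
  rw [hset, measure_iUnion]
  · refine tsum_congr fun y => ?_
    rw [h.conditional_law n y B hB _ (measurableSet_atoms_mem y hC)]
    have hmeas : Measurable fun p : (ℕ → ℝ≥0) × (ℕ → Ω) =>
        C.indicator (fun w => ∏ i, κ (w i) (B i)) (fun i => p.2 (y i)) :=
      (hκ.indicator hC).comp (measurable_pi_lambda _ fun _ => by fun_prop)
    have hpre : MeasurableSet {s | (fun k => r k s, fun k => ω k s) ∈
        {p : (ℕ → ℝ≥0) × (ℕ → Ω) | (fun i => p.2 (y i)) ∈ C}} :=
      h.measurable_atoms (measurableSet_atoms_mem y hC)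
    rw [h.setLIntegral_size_label y hmeas, ← lintegral_indicator hpre]
    refine lintegral_congr fun s => ?_
    by_cases hs : (fun i => ω (y i) s) ∈ C
    · rw [Set.indicator_of_mem (by exact hs), Set.indicator_of_mem hs]
    · rw [Set.indicator_of_notMem (by exact hs), Set.indicator_of_notMem hs, mul_zero]
  · intro y y' hy
    rw [Function.onFun, Set.disjoint_left]
    exact fun s hs hs' => hy (funext fun i => (hs.2.2.1 i).symm.trans (hs'.2.2.1 i))
  · intro y
    exact ((h.measurable_atoms (measurableSet_atoms_mem y hC)).inter
      ((h.measurableSet_size_label n y).inter hx)).congr (by ext s; simp [and_assoc])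

/-- The likelihood contains the factor `r (y i)`, so a label of zero weight has probability zero;
there are only countably many label sequences. -/
theorem ae_sampled_weight_pos (h : IsCountMixture P ρ G₀ κ r ω m z x) [IsMarkovKernel κ] (n : ℕ) :
    ∀ᵐ s ∂P, m s = n → ∀ i : Fin n, 0 < r (z i s) s := by
  have key : ∀ (y : Fin n → ℕ) (i : Fin n), ∀ᵐ s ∂P,
      ¬ ((m s = n ∧ ∀ j : Fin n, z j s = y j) ∧ r (y i) s = 0) := by
    intro y i
    have hA : MeasurableSet {p : (ℕ → ℝ≥0) × (ℕ → Ω) | p.1 (y i) = 0} :=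
      (show Measurable fun p : (ℕ → ℝ≥0) × (ℕ → Ω) => p.1 (y i) by fun_prop)
        (measurableSet_singleton 0)
    have h1 := h.conditional_law n y (fun _ => Set.univ) (fun _ => MeasurableSet.univ) _ hA
    have h2 : ∫⁻ s in {s | (fun k => r k s, fun k => ω k s) ∈
        {p : (ℕ → ℝ≥0) × (ℕ → Ω) | p.1 (y i) = 0}}, likelihood (fun k => r k s) y *
          ∏ i : Fin n, κ (ω (y i) s) Set.univ ∂P = 0 := by
      have hpre : MeasurableSet {s | (fun k => r k s, fun k => ω k s) ∈
          {p : (ℕ → ℝ≥0) × (ℕ → Ω) | p.1 (y i) = 0}} := h.measurable_atoms hA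
      rw [setLIntegral_congr_fun (g := 0) hpre]
      · simp
      · intro s hs
        have h0 : r (y i) s = 0 := hs
        have : ∏ j, ((r (y j) s / ∑' k, r k s : ℝ≥0) : ℝ≥0∞) = 0 :=
          Finset.prod_eq_zero (Finset.mem_univ i) (by simp [h0])
        simp [likelihood, this]
    rw [h2] at h1
    rw [ae_iff]
    refine measure_mono_null (fun s hs => ?_) h1
    simp only [not_not, Set.mem_ofPred_eq] at hs
    exact ⟨hs.2, hs.1.1, hs.1.2, fun _ => Set.mem_univ _⟩
  have key' : ∀ᵐ s ∂P, ∀ (y : Fin n → ℕ) (i : Fin n),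
      ¬ ((m s = n ∧ ∀ j : Fin n, z j s = y j) ∧ r (y i) s = 0) := by
    rw [ae_all_iff]
    intro y
    rw [ae_all_iff]
    exact key y
  filter_upwards [key'] with s hs hm i
  exact pos_iff_ne_zero.2 fun h0 => hs (fun j => z j s) i ⟨⟨hm, fun _ => rfl⟩, h0⟩

/-- Almost surely, two observations have the same atom if and only if they have the same label. -/
theorem ae_sampledAtom_eq_iff (h : IsCountMixture P ρ G₀ κ r ω m z x) [IsMarkovKernel κ]
    (n : ℕ) :
    ∀ᵐ s ∂P, m s = n → ∀ i j : Fin n, ω (z i s) s = ω (z j s) s ↔ z i s = z j s := by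
  filter_upwards [h.ae_sampled_weight_pos n, h.distinct] with s h1 h2 hm i j
  refine ⟨fun he => ?_, fun he => by rw [he]⟩
  by_contra hne
  exact h2 _ _ hne (h1 hm i) (h1 hm j) he

/-- After summation over the labels, weights and atoms enter only through values of the random
measure, so its independence and characteristic function become usable. -/
theorem sampledAtomLaw_rectangle (h : IsCountMixture P ρ G₀ κ r ω m z x) [IsMarkovKernel κ]
    {n : ℕ} {D : Fin n → Set Ω} (hD : ∀ i, MeasurableSet (D i)) :
    sampledAtomLaw P ω m z n {w | ∀ i, w i ∈ D i} =
      ∫⁻ s, ENNReal.ofReal (Real.exp (-(atomicMeasure (fun k => r k s) (fun k => ω k s)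
        Set.univ).toReal) / n.factorial) *
        ∏ i, atomicMeasure (fun k => r k s) (fun k => ω k s) (D i) ∂P := by
  have hset : MeasurableSet {w : Fin n → Ω | ∀ i, w i ∈ D i} := by
    rw [Set.ofPred_forall]
    exact MeasurableSet.iInter fun i => measurable_pi_apply i (hD i)
  have hprod : ∀ w : Fin n → Ω, {w : Fin n → Ω | ∀ i, w i ∈ D i}.indicator (1 : (Fin n → Ω) → ℝ≥0∞) w =
      ∏ i, (D i).indicator 1 (w i) := by
    intro w
    by_cases hw : ∀ i, w i ∈ D i
    · rw [Set.indicator_of_mem (by exact hw)]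
      simp [hw]
    · rw [Set.indicator_of_notMem (by exact hw)]
      obtain ⟨i, hi⟩ := not_forall.1 hw
      exact (Finset.prod_eq_zero (Finset.mem_univ i) (Set.indicator_of_notMem hi _)).symm
  have hind : ∀ y : Fin n → ℕ, Measurable fun p : (ℕ → ℝ≥0) × (ℕ → Ω) =>
      {w : Fin n → Ω | ∀ i, w i ∈ D i}.indicator (1 : (Fin n → Ω) → ℝ≥0∞) (fun i => p.2 (y i)) := fun y =>
    (measurable_one.indicator hset).comp (measurable_pi_lambda _ fun _ => by fun_prop)
  rw [← lintegral_indicator_one hset, h.lintegral_sampledAtomLaw (measurable_one.indicator hset)]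
  rw [tsum_congr fun y => h.setLIntegral_size_label y (hind y), ← lintegral_tsum]
  · refine lintegral_congr_ae ?_
    filter_upwards [h.ae_summable] with s hs
    have hT : (atomicMeasure (fun k => r k s) (fun k => ω k s) Set.univ).toReal =
        (∑' k, r k s : ℝ≥0) := by
      rw [atomicMeasure_univ, ← ENNReal.coe_tsum hs, ENNReal.coe_toReal]
    rw [hT, Finset.prod_congr rfl fun i _ => atomicMeasure_apply _ _ (hD i),
      ← tsum_pi_prod_eq_prod_tsum, ← ENNReal.tsum_mul_left]
    refine tsum_congr fun y => ?_
    rw [likelihood_eq hs, hprod, Finset.prod_mul_distrib, mul_assoc]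
  · intro y
    exact (((measurable_likelihood y).mul (hind y)).comp h.measurable_atoms).aemeasurable

end IsCountMixture

end

variable {S Ω X : Type*} [MeasurableSpace S] [MeasurableSpace Ω] [MeasurableSpace X]
  {P : Measure S} {ρ : Measure ℝ} {G₀ : Measure Ω} {κ : Kernel Ω X}
  {r : ℕ → S → ℝ≥0} {ω : ℕ → S → Ω} {m : S → ℕ} {z : ℕ → S → ℕ} {x : ℕ → S → X}

/-! ### Tilted moments of completely random measures -/

namespace IsCompletelyRandomMeasure

theorem mgf_eq {G : S → Measure Ω} (hG : IsCompletelyRandomMeasure P G ρ G₀)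
    [IsProbabilityMeasure P] [IsFiniteMeasure G₀] (hρ : IsLevyMeasure ρ) {A : Set Ω}
    (hA : MeasurableSet A) {t : ℝ} (ht : t ≤ 0) :
    mgf (fun s => (G s A).toReal) P t =
      Real.exp (G₀.real A * ∫ r, (Real.exp (t * r) - 1) ∂ρ) := by
  refine mgf_eq_exp_levyExponent (hG.measurable_eval A hA).ennreal_toReal
    (fun _ => ENNReal.toReal_nonneg) hρ measureReal_nonneg (fun u => ?_) ht
  rw [hG.characteristic A hA u, setIntegral_const, levyExponent, Complex.real_smul]

theorem integral_pow_mul_exp_neg {G : S → Measure Ω} (hG : IsCompletelyRandomMeasure P G ρ G₀)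
    [IsProbabilityMeasure P] [IsFiniteMeasure G₀] (hρ : IsLevyMeasure ρ) {A : Set Ω}
    (hA : MeasurableSet A) (n : ℕ) :
    ∫ s, (G s A).toReal ^ n * Real.exp (-(G s A).toReal) ∂P =
      tiltedMoment (levyMoment ρ) n (G₀.real A) *
        Real.exp (G₀.real A * ∫ r, (Real.exp (-r) - 1) ∂ρ) :=
  CountMixture.integral_pow_mul_exp_neg (hG.measurable_eval A hA).ennreal_toReal
    (fun _ => ENNReal.toReal_nonneg) hρ (fun _ ht => hG.mgf_eq hρ hA ht) n

theorem integral_exp_neg_mul_prod {G : S → Measure Ω} (hG : IsCompletelyRandomMeasure P G ρ G₀)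
    [IsProbabilityMeasure P] [IsFiniteMeasure G₀] (hρ : IsLevyMeasure ρ) {l : ℕ}
    {D : Fin l → Set Ω} (hD : ∀ k, MeasurableSet (D k))
    (hdisj : Pairwise fun j k => Disjoint (D j) (D k)) (n : Fin l → ℕ) :
    ∫ s, Real.exp (-(G s Set.univ).toReal) * ∏ k, (G s (D k)).toReal ^ n k ∂P =
      Real.exp (G₀.real Set.univ * ∫ r, (Real.exp (-r) - 1) ∂ρ) *
        ∏ k, tiltedMoment (levyMoment ρ) (n k) (G₀.real (D k)) := by
  -- Adding the complement gives a partition of `Ω`, across which `e^{-G(Ω)}` factors; `R` itself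
  -- contributes only a tilted moment of order 0.
  set R : Set Ω := (⋃ k, D k)ᶜ with hR
  have hRm : MeasurableSet R := (MeasurableSet.iUnion hD).compl
  set A : Fin (l + 1) → Set Ω := Fin.cons R D with hA
  have hAm : ∀ i, MeasurableSet (A i) := by
    intro i
    refine Fin.cases ?_ (fun k => ?_) i
    · simpa [hA] using hRm
    · simpa [hA] using hD k
  have hRD : ∀ k, Disjoint R (D k) := fun k =>
    Set.disjoint_left.2 fun _ hx hk => hx (Set.mem_iUnion.2 ⟨k, hk⟩)
  have hAd : Pairwise fun i j => Disjoint (A i) (A j) := by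
    intro i j
    refine Fin.cases ?_ (fun k => ?_) i <;> refine Fin.cases ?_ (fun k' => ?_) j
    · simp
    · simpa [hA] using fun _ => hRD k'
    · simpa [hA] using (hRD k).symm
    · simp only [hA, Fin.cons_succ, ne_eq, Fin.succ_inj]
      exact fun h => hdisj h
  have hAu : ⋃ i, A i = Set.univ := by
    refine Set.eq_univ_of_forall fun w => ?_
    by_cases hw : w ∈ ⋃ k, D k
    · obtain ⟨k, hk⟩ := Set.mem_iUnion.1 hw
      exact Set.mem_iUnion.2 ⟨k.succ, by simpa [hA] using hk⟩
    · exact Set.mem_iUnion.2 ⟨0, by simpa [hA, hR] using hw⟩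
  set g : Fin (l + 1) → ℝ≥0∞ → ℝ := Fin.cons (fun t => Real.exp (-t.toReal))
    fun k t => t.toReal ^ n k * Real.exp (-t.toReal) with hg
  have hgm : ∀ i, Measurable (g i) := by
    intro i
    refine Fin.cases ?_ (fun k => ?_) i
    · simp only [hg, Fin.cons_zero]
      fun_prop
    · simp only [hg, Fin.cons_succ]
      fun_prop
  have h1 : ∫ s, Real.exp (-(G s Set.univ).toReal) * ∏ k, (G s (D k)).toReal ^ n k ∂P =
      ∫ s, ∏ i, g i (G s (A i)) ∂P := by
    refine integral_congr_ae ?_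
    filter_upwards [hG.ae_finite] with s hs
    have hfin : ∀ B, G s B ≠ ∞ := fun B => ((measure_mono (Set.subset_univ B)).trans_lt hs).ne
    have hT : (G s Set.univ).toReal = (G s R).toReal + ∑ k, (G s (D k)).toReal := by
      rw [← hAu, measure_iUnion hAd hAm, tsum_fintype, ENNReal.toReal_sum fun i _ => hfin _,
        Fin.sum_univ_succ]
      simp [hA]
    rw [hT, Fin.prod_univ_succ]
    simp only [hg, hA, Fin.cons_zero, Fin.cons_succ]
    rw [neg_add, Real.exp_add, Finset.prod_mul_distrib, ← Finset.sum_neg_distrib, Real.exp_sum]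
    ring
  rw [h1, (hG.indep (l + 1) A hAm hAd).integral_fun_prod_comp
    (fun i => (hG.measurable_eval _ (hAm i)).aemeasurable)
    (fun i => (hgm i).aestronglyMeasurable), Fin.prod_univ_succ]
  simp only [hg, hA, Fin.cons_zero, Fin.cons_succ]
  have h0 := hG.integral_pow_mul_exp_neg hρ hRm 0
  simp only [pow_zero, one_mul, tiltedMoment] at h0
  rw [h0, Finset.prod_congr rfl fun k _ => hG.integral_pow_mul_exp_neg hρ (hD k) (n k),
    Finset.prod_mul_distrib, ← Real.exp_sum, mul_left_comm, ← Real.exp_add, ← Finset.sum_mul,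
    ← add_mul, mul_comm]
  congr 4
  simp only [measureReal_def]
  rw [← hAu, measure_iUnion hAd hAm, tsum_fintype,
    ENNReal.toReal_sum fun i _ => measure_ne_top _ _, Fin.sum_univ_succ]
  simp [hA]

end IsCompletelyRandomMeasure

/-! ### The marginal law of the sample size -/

theorem sizePMF_eq {G : S → Measure Ω} (hG : IsCompletelyRandomMeasure P G ρ G₀)
    [IsProbabilityMeasure P] [IsFiniteMeasure G₀] (hρ : IsLevyMeasure ρ) (n : ℕ) :
    sizePMF (G₀.real Set.univ) ρ n =
      ∫ s, Real.exp (-(G s Set.univ).toReal) / n.factorial * (G s Set.univ).toReal ^ n ∂P := by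
  set Y : S → ℝ := fun s => (G s Set.univ).toReal with hY
  have hYm : Measurable Y := (hG.measurable_eval _ MeasurableSet.univ).ennreal_toReal
  -- The generating function of a mixed Poisson variable is the Laplace transform of its intensity,
  -- shifted by one. Equality near 0 suffices for the derivatives.
  have h1 : sizePGF (G₀.real Set.univ) ρ =ᶠ[𝓝 0] fun t => mgf Y P (t - 1) := by
    filter_upwards [isOpen_Iio.mem_nhds (show (0 : ℝ) ∈ Set.Iio 1 by norm_num)] with t ht
    rw [hG.mgf_eq hρ MeasurableSet.univ (by linarith [Set.mem_Iio.1 ht]), sizePGF]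
    simp only [neg_sub]
  have hint : (-1 : ℝ) ∈ interior (integrableExpSet Y P) :=
    mem_interior_integrableExpSet (fun t ht => integrable_exp_mul_of_nonneg hYm
      (fun _ => ENNReal.toReal_nonneg) ht.le) (by norm_num)
  rw [sizePMF, (h1.iteratedDeriv n).eq_of_nhds, iteratedDeriv_comp_sub_const]
  simp only [zero_sub]
  rw [iteratedDeriv_mgf hint, ← integral_div]
  refine integral_congr_ae (Eventually.of_forall fun s => ?_)
  simp only [neg_mul, one_mul]
  ring

namespace IsCountMixture

theorem sampledAtomLaw_real_rectangle (h : IsCountMixture P ρ G₀ κ r ω m z x)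
    [IsMarkovKernel κ] {n : ℕ} {D : Fin n → Set Ω} (hD : ∀ i, MeasurableSet (D i)) :
    (sampledAtomLaw P ω m z n).real {w | ∀ i, w i ∈ D i} =
      ∫ s, Real.exp (-(atomicMeasure (fun k => r k s) (fun k => ω k s) Set.univ).toReal) /
        n.factorial * ∏ i, (atomicMeasure (fun k => r k s) (fun k => ω k s) (D i)).toReal ∂P := by
  have hm : ∀ A, MeasurableSet A → Measurable fun s =>
    atomicMeasure (fun k => r k s) (fun k => ω k s) A := h.completelyRandom.measurable_eval
  have hmu := hm _ MeasurableSet.univ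
  rw [measureReal_def, h.sampledAtomLaw_rectangle hD, ← integral_toReal]
  · refine integral_congr_ae (Eventually.of_forall fun s => ?_)
    simp only [ENNReal.toReal_mul, ENNReal.toReal_prod]
    rw [ENNReal.toReal_ofReal (by positivity)]
  · refine Measurable.aemeasurable (Measurable.mul (by fun_prop) ?_)
    exact Finset.measurable_prod _ fun i _ => hm _ (hD i)
  · filter_upwards [h.completelyRandom.ae_finite] with s hs
    refine ENNReal.mul_lt_top ENNReal.ofReal_lt_top (ENNReal.prod_lt_top fun i _ => ?_)
    exact (measure_mono (Set.subset_univ _)).trans_lt hs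

theorem measureReal_size (h : IsCountMixture P ρ G₀ κ r ω m z x) [IsProbabilityMeasure P]
    [IsFiniteMeasure G₀] [IsMarkovKernel κ] (hρ : IsLevyMeasure ρ) (n : ℕ) :
    P.real {s | m s = n} = sizePMF (G₀.real Set.univ) ρ n := by
  rw [sizePMF_eq h.completelyRandom hρ]
  have h1 := h.sampledAtomLaw_real_rectangle (n := n) (D := fun _ => Set.univ)
    fun _ => MeasurableSet.univ
  simp only [Finset.prod_const, Finset.card_univ, Fintype.card_fin] at h1
  rw [← h1, sampledAtomLaw, measureReal_def, measureReal_def,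
    show {w : Fin n → Ω | ∀ i, w i ∈ Set.univ} = Set.univ by ext; simp,
    Measure.map_apply (h.measurable_sampledAtoms n) MeasurableSet.univ]
  simp

instance [IsFiniteMeasure P] (n : ℕ) : IsFiniteMeasure (sampledAtomLaw P ω m z n) := by
  unfold sampledAtomLaw
  infer_instance

/-- The law of the sampled atoms on the set of samples with pattern of coincidences `q`. -/
theorem sampledAtomLaw_pattern (h : IsCountMixture P ρ G₀ κ r ω m z x) [IsProbabilityMeasure P]
    [IsFiniteMeasure G₀] [NullSingletonClass G₀] [MeasurableSpace.CountablySeparated Ω]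
    [IsMarkovKernel κ] (hρ : IsLevyMeasure ρ) {n l : ℕ} {q : Fin n → Fin l}
    (hq : Function.Surjective q) {A : Fin l → Set Ω} (hA : ∀ k, MeasurableSet (A k)) :
    (sampledAtomLaw P ω m z n).real {w | (∀ i j, w i = w j ↔ q i = q j) ∧ ∀ i, w i ∈ A (q i)} =
      Real.exp (G₀.real Set.univ * ∫ r, (Real.exp (-r) - 1) ∂ρ) / n.factorial *
        ∏ k, (G₀.real (A k) *
          levyMoment ρ (Finset.univ.filter fun i => q i = k).card) := by
  -- Nonempty clusters are what allow a factor `G₀(D k)` to be extracted from each tilted moment.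
  have hcard : ∀ k, (Finset.univ.filter fun i => q i = k).card ≠ 0 := by
    intro k
    obtain ⟨i, hi⟩ := hq k
    exact Finset.card_ne_zero_of_mem (Finset.mem_filter.2 ⟨Finset.mem_univ i, hi⟩)
  rw [measureReal_pattern_inter_rectangle G₀ (sampledAtomLaw P ω m z n) q hq
    (fun k => tiltedMomentQuotient (levyMoment ρ) (Finset.univ.filter fun i => q i = k).card)
    (fun k => continuous_tiltedMomentQuotient _ _)
    (Real.exp (G₀.real Set.univ * ∫ r, (Real.exp (-r) - 1) ∂ρ) / n.factorial) ?_ A hA]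
  · simp only [tiltedMomentQuotient_zero _ (hcard _)]
  · intro D hD hdisj
    rw [h.sampledAtomLaw_real_rectangle (D := fun i => D (q i)) fun i => hD _]
    simp only [← tiltedMoment_eq_mul_quotient _ (hcard _)]
    rw [div_mul_eq_mul_div, ← h.completelyRandom.integral_exp_neg_mul_prod hρ hD hdisj,
      ← integral_div]
    refine integral_congr_ae (Eventually.of_forall fun s => ?_)
    dsimp only
    rw [div_mul_eq_mul_div, ← Finset.prod_fiberwise_of_maps_to (s := Finset.univ)
      (t := Finset.univ) (g := q) fun _ _ => Finset.mem_univ _]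
    congr 2
    refine Finset.prod_congr rfl fun k _ => ?_
    rw [Finset.prod_congr rfl (g := fun _ =>
      (atomicMeasure (fun k => r k s) (fun k => ω k s) (D k)).toReal), Finset.prod_const]
    intro i hi
    rw [(Finset.mem_filter.1 hi).2]

end IsCountMixture

section

/-! ### Relabelling in order of appearance -/

theorem label_firstIndex {n : ℕ} (z : Fin n → ℕ) (i : Fin n) : z (firstIndex z i) = z i :=
  (Finset.mem_filter.1 (Finset.min'_mem (Finset.univ.filter fun j => z j = z i)
    ⟨i, by simp⟩)).2

theorem firstIndex_le {n : ℕ} {z : Fin n → ℕ} {i j : Fin n} (h : z j = z i) :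
    firstIndex z i ≤ j :=
  Finset.min'_le _ _ (by simpa using h)

theorem firstIndex_eq_iff {n : ℕ} {z : Fin n → ℕ} {i j : Fin n} :
    firstIndex z i = firstIndex z j ↔ z i = z j := by
  constructor
  · intro h
    rw [← label_firstIndex z i, h, label_firstIndex z]
  · intro h
    exact le_antisymm (firstIndex_le (by rw [label_firstIndex z, h]))
      (firstIndex_le (by rw [label_firstIndex z, h]))

theorem appearance_relabel {n : ℕ} (z : Fin n → ℕ) (i : Fin n) :
    (appearance z (relabel z i) : Fin n) = firstIndex z i := by
  simp [relabel]

theorem relabel_eq_iff {n : ℕ} {z : Fin n → ℕ} {i j : Fin n} :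
    relabel z i = relabel z j ↔ z i = z j := by
  rw [← firstIndex_eq_iff, relabel, relabel, (appearance z).symm.injective.eq_iff]
  exact Subtype.ext_iff

theorem relabel_appearance {n : ℕ} (z : Fin n → ℕ) (k : Fin (numClusters z)) :
    relabel z (appearance z k : Fin n) = k := by
  obtain ⟨i, -, hi⟩ := Finset.mem_image.1 (appearance z k).2
  have h : firstIndex z (appearance z k : Fin n) = appearance z k := by
    rw [← hi, firstIndex_eq_iff, label_firstIndex z]
  have h2 : appearance z (relabel z (appearance z k : Fin n)) = appearance z k :=
    Subtype.ext (by rw [appearance_relabel, h])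
  exact (appearance z).injective h2

theorem isAppearanceOrdered_relabel {n : ℕ} (z : Fin n → ℕ) :
    IsAppearanceOrdered (relabel z) := by
  refine ⟨fun k => ⟨_, relabel_appearance z k⟩, fun j k hjk => ?_⟩
  refine ⟨appearance z j, relabel_appearance z j, fun i' hi' => ?_⟩
  have h1 : (appearance z j : Fin n) < appearance z k := (appearance z).lt_iff_lt.2 hjk
  rw [← hi', appearance_relabel] at h1
  exact h1.trans_le (firstIndex_le rfl)

/-- Labels in order of appearance are determined by their pattern of coincidences. -/
theorem IsAppearanceOrdered.eq_of_pattern {n l l' : ℕ} {q : Fin n → Fin l} {q' : Fin n → Fin l'}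
    (hq : IsAppearanceOrdered q) (hq' : IsAppearanceOrdered q')
    (h : ∀ i j, q i = q j ↔ q' i = q' j) : (⟨l, q⟩ : Labels n) = ⟨l', q'⟩ := by
  set σ : Fin l → Fin l' := fun k => q' (Function.surjInv hq.1 k) with hσ
  have hσq : ∀ i, σ (q i) = q' i := fun i => (h _ _).1 (Function.surjInv_eq hq.1 _)
  -- Label `j` appears before `k` in `q`. If `σ k < σ j`, then `q'` shows them in the opposite
  -- order; if `σ j = σ k`, the patterns differ.
  have hmono : StrictMono σ := by
    intro j k hjk
    by_contra hlt
    obtain ⟨i, hi, hi'⟩ := hq.2 j k hjk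
    rcases lt_or_eq_of_le (not_lt.1 hlt) with hlt | heq
    · obtain ⟨i₀, h₀, h₀'⟩ := hq'.2 _ _ hlt
      obtain ⟨i₁, rfl⟩ := hq.1 k
      rw [hσq] at h₀
      exact absurd (h₀' i (by rw [← hi, hσq])) (not_lt.2 (hi' i₀ ((h _ _).2 h₀)).le)
    · obtain ⟨i₁, rfl⟩ := hq.1 k
      rw [← hi, hσq, hσq] at heq
      have := (h _ _).2 heq
      rw [hi] at this
      exact absurd this.symm hjk.ne
  have hsurj : Function.Surjective σ := fun k => by
    obtain ⟨i, rfl⟩ := hq'.1 k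
    exact ⟨q i, hσq i⟩
  have hl : l = l' := by
    simpa using Fintype.card_of_bijective (f := σ) ⟨hmono.injective, hsurj⟩
  subst hl
  -- The only order automorphism of `Fin l` is the identity.
  have hid : ∀ k, σ k = k := fun k =>
    DFunLike.congr_fun (Subsingleton.elim (StrictMono.orderIsoOfSurjective σ hmono hsurj)
      (OrderIso.refl (Fin l))) k
  have : q = q' := funext fun i => by rw [← hσq i, hid]
  rw [this]

theorem relabel_eq_labels_iff {n : ℕ} {z : Fin n → ℕ} {q : Labels n}
    (hq : IsAppearanceOrdered q.2) :
    (⟨_, relabel z⟩ : Labels n) = q ↔ ∀ i j, z i = z j ↔ q.2 i = q.2 j := by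
  constructor
  · rintro rfl i j
    exact relabel_eq_iff.symm
  · intro h
    exact (isAppearanceOrdered_relabel z).eq_of_pattern hq
      fun i j => relabel_eq_iff.trans (h i j)

/-- The atom of a cluster can be read off at any of its members, so an arbitrary section `σ` of the
labels replaces the first appearances. -/
theorem outcome_eq_of_relabel_eq {Ω X : Type*} {n : ℕ} {z : Fin n → ℕ} {q : Labels n}
    (h : (⟨_, relabel z⟩ : Labels n) = q) {σ : Fin q.1 → Fin n} (hσ : ∀ k, q.2 (σ k) = k)
    (ω : ℕ → Ω) (x : Fin n → X) :
    outcome ω z x = ⟨(n, q.1), q.2, fun k => ω (z (σ k)), x⟩ := by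
  subst h
  have : (fun k => ω (originalLabel z k)) = fun k => ω (z (σ k)) := by
    funext k
    rw [originalLabel, relabel_eq_iff.1 ((relabel_appearance z k).trans (hσ k).symm)]
  rw [outcome, this]

/-! ### The laws of the two-step construction -/

theorem measurable_sigmaMk {α : Type*} {β : α → Type*} [∀ a, MeasurableSpace (β a)] (a : α) :
    Measurable (Sigma.mk a : β a → Sigma β) := by
  intro s hs
  exact MeasurableSpace.measurableSet_iInf.1 hs a

instance (n : ℕ) : DiscreteMeasurableSpace (Labels n) :=
  ⟨fun s => MeasurableSpace.measurableSet_iInf.2 fun l =>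
    (MeasurableSet.of_discrete : MeasurableSet (Sigma.mk l ⁻¹' s))⟩

variable {Ω X : Type*} [MeasurableSpace Ω] [MeasurableSpace X]

theorem isProbabilityMeasure_baseLaw (G₀ : Measure Ω) [IsFiniteMeasure G₀] (hG₀ : G₀ ≠ 0) :
    IsProbabilityMeasure (baseLaw G₀) :=
  ⟨by
    rw [baseLaw, Measure.smul_apply, smul_eq_mul]
    exact ENNReal.inv_mul_cancel (by simpa using hG₀) (measure_ne_top _ _)⟩

theorem observationKernel_apply (κ : Kernel Ω X) [IsMarkovKernel κ] {n l : ℕ} (q : Fin n → Fin l)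
    (v : Fin l → Ω) : observationKernel κ q v = Measure.pi fun i => κ (v (q i)) := rfl

instance (κ : Kernel Ω X) [IsMarkovKernel κ] {n l : ℕ} (q : Fin n → Fin l) :
    IsMarkovKernel (observationKernel κ q) :=
  ⟨fun v => by
    rw [observationKernel_apply]
    infer_instance⟩

theorem measurable_outcome_mk {n l : ℕ} (q : Fin n → Fin l) :
    Measurable fun wx : (Fin l → Ω) × (Fin n → X) => (⟨(n, l), q, wx.1, wx.2⟩ : Outcome Ω X) :=
  (measurable_sigmaMk (β := fun p : ℕ × ℕ =>
    (Fin p.1 → Fin p.2) × (Fin p.2 → Ω) × (Fin p.1 → X)) (n, l)).comp (by fun_prop)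

theorem isProbabilityMeasure_outcomeLaw (G₀ : Measure Ω) [IsFiniteMeasure G₀] (hG₀ : G₀ ≠ 0)
    (κ : Kernel Ω X) [IsMarkovKernel κ] {n l : ℕ} (q : Fin n → Fin l) :
    IsProbabilityMeasure (outcomeLaw G₀ κ q) := by
  have := isProbabilityMeasure_baseLaw G₀ hG₀
  exact Measure.isProbabilityMeasure_map (measurable_outcome_mk q).aemeasurable

theorem twoStepLaw_apply (ρ : Measure ℝ) (G₀ : Measure Ω) (κ : Kernel Ω X) [IsMarkovKernel κ]
    {A : Set (Outcome Ω X)} (hA : MeasurableSet A) :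
    twoStepLaw ρ G₀ κ A = ∑' (n : ℕ) (q : Labels n),
      ENNReal.ofReal (sizePMF (G₀.real Set.univ) ρ n) *
        (ENNReal.ofReal (eppf (G₀.real Set.univ) ρ q.2) * outcomeLaw G₀ κ q.2 A) := by
  rw [twoStepLaw, Measure.bind_apply hA measurable_from_nat.aemeasurable, sizeLaw,
    lintegral_sum_measure]
  refine tsum_congr fun n => ?_
  rw [lintegral_smul_measure, lintegral_dirac,
    Measure.bind_apply hA (Measurable.of_discrete).aemeasurable, labelLaw, lintegral_sum_measure,
    smul_eq_mul, ← ENNReal.tsum_mul_left]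
  refine tsum_congr fun q => ?_
  rw [lintegral_smul_measure, lintegral_dirac, smul_eq_mul]

/-- For fixed `C`, both sides are finite measures in the second coordinate that agree on the
generating π-system of rectangles. -/
theorem ext_prod_pi {α ι : Type*} [MeasurableSpace α] [Fintype ι]
    {μ ν : Measure (α × (ι → X))} [IsFiniteMeasure μ] [IsFiniteMeasure ν]
    (h : ∀ (C : Set α) (B : ι → Set X), MeasurableSet C → (∀ i, MeasurableSet (B i)) →
      μ (C ×ˢ Set.univ.pi B) = ν (C ×ˢ Set.univ.pi B)) : μ = ν := by
  refine Measure.ext_prod fun {C t} hC ht => ?_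
  have hcond : ∀ (μ : Measure (α × (ι → X))) (t : Set (ι → X)), MeasurableSet t →
      (μ.restrict (C ×ˢ Set.univ)).map Prod.snd t = μ (C ×ˢ t) := by
    intro μ t ht
    rw [Measure.map_apply measurable_snd ht, Measure.restrict_apply (measurable_snd ht)]
    congr 1
    ext p
    simp [and_comm]
  rw [← hcond μ t ht, ← hcond ν t ht]
  congr 1
  refine ext_of_generate_finite _ generateFrom_pi.symm isPiSystem_pi ?_ ?_
  · rintro _ ⟨B, hB, rfl⟩
    have hB' : ∀ i, MeasurableSet (B i) := fun i => hB i (Set.mem_univ i)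
    rw [hcond μ _ (MeasurableSet.univ_pi hB'), hcond ν _ (MeasurableSet.univ_pi hB')]
    exact h C B hC hB'
  · rw [hcond μ _ MeasurableSet.univ, hcond ν _ MeasurableSet.univ]
    simpa using h C (fun _ => Set.univ) hC fun _ => MeasurableSet.univ

end

section

/-! ### The law of the outcome -/

section LabelEvent

variable {S Ω X : Type*} {ω : ℕ → S → Ω} {m : S → ℕ} {z : ℕ → S → ℕ} {x : ℕ → S → X}

/-- The event that the sample size is `n` and that the labels in order of appearance are `q`. -/
def labelEvent (m : S → ℕ) (z : ℕ → S → ℕ) {n : ℕ} (q : Labels n) : Set S :=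
  {s | m s = n ∧ (⟨_, relabel fun i : Fin n => z i s⟩ : Labels n) = q}

theorem outcome_eq_of_mem_labelEvent {n : ℕ} {q : Labels n} {σ : Fin q.1 → Fin n}
    (hσ : ∀ k, q.2 (σ k) = k) {s : S} (hs : s ∈ labelEvent m z q) :
    outcome (fun k => ω k s) (fun i : Fin (m s) => z i s) (fun i : Fin (m s) => x i s) =
      ⟨(n, q.1), q.2, fun k => ω (z (σ k) s) s, fun i => x i s⟩ := by
  obtain ⟨rfl, hq⟩ := hs
  exact outcome_eq_of_relabel_eq hq hσ _ _

theorem labelEvent_eq_empty {n : ℕ} {q : Labels n} (hq : ¬ IsAppearanceOrdered q.2) :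
    labelEvent m z q = (∅ : Set S) := by
  refine Set.eq_empty_of_forall_notMem fun s hs => hq ?_
  rw [← hs.2]
  exact isAppearanceOrdered_relabel _

/-- On a label event the outcome stays in one fixed component of the dependent sum, where it is an
ordinary map into a product space. -/
theorem preimage_outcome_inter_labelEvent {n : ℕ} {q : Labels n} {σ : Fin q.1 → Fin n}
    (hσ : ∀ k, q.2 (σ k) = k) (A : Set (Outcome Ω X)) :
    (fun s => outcome (fun k => ω k s) (fun i : Fin (m s) => z i s) fun i : Fin (m s) => x i s) ⁻¹'
        A ∩ labelEvent m z q =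
      (fun s => (fun k => ω (z (σ k) s) s, fun i : Fin n => x i s)) ⁻¹'
        ((fun wx : (Fin q.1 → Ω) × (Fin n → X) => (⟨(n, q.1), q.2, wx.1, wx.2⟩ : Outcome Ω X)) ⁻¹'
          A) ∩ labelEvent m z q := by
  ext s
  simp only [Set.mem_inter_iff, Set.mem_preimage, and_congr_left_iff]
  intro hs
  rw [outcome_eq_of_mem_labelEvent hσ hs]

theorem iUnion_labelEvent (m : S → ℕ) (z : ℕ → S → ℕ) (n : ℕ) :
    ⋃ q : Labels n, labelEvent m z q = {s | m s = n} := by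
  ext s
  simp only [Set.mem_iUnion, labelEvent, Set.mem_ofPred_eq]
  exact ⟨fun ⟨_, hm, _⟩ => hm, fun hm => ⟨_, hm, rfl⟩⟩

theorem pairwise_disjoint_labelEvent (m : S → ℕ) (z : ℕ → S → ℕ) (n : ℕ) :
    Pairwise (Function.onFun Disjoint fun q : Labels n => labelEvent m z q) := by
  intro q q' hqq'
  rw [Function.onFun, Set.disjoint_left]
  exact fun s hs hs' => hqq' (hs.2.symm.trans hs'.2)

theorem preimage_eq_iUnion_labelEvent (m : S → ℕ) (z : ℕ → S → ℕ) (B : Set S) :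
    B = ⋃ n, ⋃ q : Labels n, B ∩ labelEvent m z q := by
  simp_rw [← Set.inter_iUnion, iUnion_labelEvent]
  ext s
  simp

end LabelEvent

variable {S Ω X : Type*} [MeasurableSpace S] [MeasurableSpace Ω] [MeasurableSpace X]
  {P : Measure S} {ρ : Measure ℝ} {G₀ : Measure Ω} {κ : Kernel Ω X}
  {r : ℕ → S → ℝ≥0} {ω : ℕ → S → Ω} {m : S → ℕ} {z : ℕ → S → ℕ} {x : ℕ → S → X}

theorem ecpf_nonneg (hρ : IsLevyMeasure ρ) {γ : ℝ} (hγ : 0 ≤ γ) {n l : ℕ} (q : Fin n → Fin l) :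
    0 ≤ ecpf γ ρ q := by
  rw [ecpf]
  split_ifs
  · refine mul_nonneg (by positivity) (Finset.prod_nonneg fun k _ => ?_)
    refine integral_nonneg_of_ae ?_
    filter_upwards [hρ.ae_pos] with r hr
    positivity
  · exact le_rfl

/-- The points of `Ωⁿ` whose pattern of coincidences is `q`. -/
def patternSet (Ω : Type*) {n l : ℕ} (q : Fin n → Fin l) : Set (Fin n → Ω) :=
  {w | ∀ i j, w i = w j ↔ q i = q j}

theorem measurableSet_patternSet [MeasurableSpace.CountablySeparated Ω] {n l : ℕ}
    (q : Fin n → Fin l) : MeasurableSet (patternSet Ω q) := by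
  have := measurableEq_of_countablySeparated Ω
  rw [patternSet, Set.ofPred_forall]
  refine MeasurableSet.iInter fun i => ?_
  rw [Set.ofPred_forall]
  refine MeasurableSet.iInter fun j => ?_
  have h1 := measurableSet_eq_fun (measurable_pi_apply (X := fun _ : Fin n => Ω) i)
    (measurable_pi_apply j)
  by_cases h : q i = q j
  · simpa [h] using h1
  · simp only [h, iff_false]
    exact h1.compl

theorem measurable_comp_index {n l : ℕ} (σ : Fin l → Fin n) :
    Measurable fun (w : Fin n → Ω) k => w (σ k) :=
  measurable_pi_lambda _ fun k => measurable_pi_apply (σ k)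

namespace IsCountMixture

theorem measurable_cluster (h : IsCountMixture P ρ G₀ κ r ω m z x) {n l : ℕ}
    (σ : Fin l → Fin n) :
    Measurable fun s => ((fun k => ω (z (σ k) s) s, fun i => x i s) :
      (Fin l → Ω) × (Fin n → X)) :=
  (measurable_pi_lambda _ fun k => h.measurable_sampledAtom (σ k)).prodMk
    (measurable_pi_lambda _ fun i => h.measurable_obs i)

/-- The law of the atoms of the clusters, in order of appearance. -/
theorem map_sampledAtomLaw_restrict_pattern (h : IsCountMixture P ρ G₀ κ r ω m z x)
    [IsProbabilityMeasure P] [IsFiniteMeasure G₀] [NullSingletonClass G₀] (hG₀ : G₀ ≠ 0)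
    [MeasurableSpace.CountablySeparated Ω] [IsMarkovKernel κ] (hρ : IsLevyMeasure ρ) {n l : ℕ}
    {q : Fin n → Fin l} (hq : IsAppearanceOrdered q) {σ : Fin l → Fin n}
    (hσ : ∀ k, q (σ k) = k) :
    ((sampledAtomLaw P ω m z n).restrict (patternSet Ω q)).map (fun w k => w (σ k)) =
      ENNReal.ofReal (ecpf (G₀.real Set.univ) ρ q) • Measure.pi fun _ : Fin l => baseLaw G₀ := by
  have := isProbabilityMeasure_baseLaw G₀ hG₀
  have hrect : ∀ A : Fin l → Set Ω, (∀ k, MeasurableSet (A k)) →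
      ((sampledAtomLaw P ω m z n).restrict (patternSet Ω q)).map (fun w k => w (σ k))
        (Set.univ.pi A) = (ENNReal.ofReal (ecpf (G₀.real Set.univ) ρ q) •
          Measure.pi fun _ : Fin l => baseLaw G₀) (Set.univ.pi A) := by
    intro A hA
    have hset : (fun (w : Fin n → Ω) k => w (σ k)) ⁻¹' Set.univ.pi A ∩ patternSet Ω q =
        {w | (∀ i j, w i = w j ↔ q i = q j) ∧ ∀ i, w i ∈ A (q i)} := by
      ext w
      simp only [patternSet, Set.mem_inter_iff, Set.mem_preimage, Set.mem_univ_pi,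
        Set.mem_ofPred_eq]
      constructor
      · rintro ⟨h1, h2⟩
        refine ⟨h2, fun i => ?_⟩
        rw [(h2 i (σ (q i))).2 (hσ _).symm]
        exact h1 (q i)
      · rintro ⟨h1, h2⟩
        exact ⟨fun k => by simpa only [hσ] using h2 (σ k), h1⟩
    -- Needed to cancel `γ₀ˡ` in the ECPF against the `l` normalisations of `baseLaw`.
    have hγ : G₀.real Set.univ ≠ 0 := by simpa [measureReal_def, ENNReal.toReal_eq_zero_iff]
    rw [Measure.map_apply (measurable_comp_index σ) (MeasurableSet.univ_pi hA),
      Measure.restrict_apply ((measurable_comp_index σ) (MeasurableSet.univ_pi hA)), hset,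
      Measure.smul_apply, Measure.pi_pi, smul_eq_mul,
      ← ofReal_measureReal (μ := sampledAtomLaw P ω m z n),
      h.sampledAtomLaw_pattern hρ hq.1 hA]
    have hb : ∀ k, baseLaw G₀ (A k) = ENNReal.ofReal (G₀.real (A k) / G₀.real Set.univ) := by
      intro k
      rw [← ofReal_measureReal, baseLaw, measureReal_def, Measure.smul_apply, smul_eq_mul,
        ENNReal.toReal_mul, ENNReal.toReal_inv, mul_comm, div_eq_mul_inv]
      rfl
    rw [Finset.prod_congr rfl fun k _ => hb k, ← ENNReal.ofReal_prod_of_nonneg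
      (fun k _ => by positivity), ← ENNReal.ofReal_mul (ecpf_nonneg hρ measureReal_nonneg q),
      ecpf, if_pos hq, Finset.prod_mul_distrib, Finset.prod_div_distrib, Finset.prod_const,
      Finset.card_univ, Fintype.card_fin]
    congr 1
    simp only [levyMoment]
    field_simp
  refine ext_of_generate_finite _ generateFrom_pi.symm isPiSystem_pi ?_ ?_
  · rintro _ ⟨A, hA, rfl⟩
    exact hrect A fun k => hA k (Set.mem_univ k)
  · simpa only [Set.pi_univ] using hrect (fun _ => Set.univ) fun _ => MeasurableSet.univ

/-- Appearance-ordered labels are determined by their coincidences, and almost surely these are the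
coincidences of the sampled atoms. The arbitrary numbering of the atoms thus drops out. -/
theorem labelEvent_ae_eq (h : IsCountMixture P ρ G₀ κ r ω m z x) [IsMarkovKernel κ] {n : ℕ}
    {q : Labels n} (hq : IsAppearanceOrdered q.2) :
    (labelEvent m z q : Set S) =ᵐ[P]
      {s | m s = n ∧ (fun i : Fin n => ω (z i s) s) ∈ patternSet Ω q.2} := by
  refine eventuallyEq_set.2 ?_
  filter_upwards [h.ae_sampledAtom_eq_iff n] with s hs
  refine and_congr_right fun hm => ?_
  rw [relabel_eq_labels_iff hq]
  exact forall_congr' fun i => forall_congr' fun j => by rw [hs hm i j]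

theorem measurableSet_labelEvent (h : IsCountMixture P ρ G₀ κ r ω m z x) {n : ℕ} (q : Labels n) :
    MeasurableSet (labelEvent m z q) := by
  have : labelEvent m z q = ⋃ y ∈ {y : Fin n → ℕ | (⟨_, relabel y⟩ : Labels n) = q},
      {s | m s = n ∧ ∀ i : Fin n, z i s = y i} := by
    ext s
    simp only [labelEvent, Set.mem_ofPred_eq, Set.mem_iUnion, exists_prop]
    constructor
    · rintro ⟨h1, h2⟩
      exact ⟨_, h2, h1, fun _ => rfl⟩
    · rintro ⟨y, h2, h1, h3⟩
      obtain rfl : (fun i : Fin n => z i s) = y := funext h3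
      exact ⟨h1, h2⟩
  rw [this]
  exact MeasurableSet.biUnion (Set.to_countable _) fun y _ => h.measurableSet_size_label n y

/-- The joint law of the atoms of the clusters and of the observations, on the event that the
labels are `q`. -/
theorem map_restrict_labelEvent (h : IsCountMixture P ρ G₀ κ r ω m z x)
    [IsProbabilityMeasure P] [IsFiniteMeasure G₀] [NullSingletonClass G₀] (hG₀ : G₀ ≠ 0)
    [MeasurableSpace.CountablySeparated Ω] [IsMarkovKernel κ] (hρ : IsLevyMeasure ρ) {n : ℕ}
    {q : Labels n} (hq : IsAppearanceOrdered q.2) {σ : Fin q.1 → Fin n}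
    (hσ : ∀ k, q.2 (σ k) = k) :
    (P.restrict (labelEvent m z q)).map
        (fun s => (fun k => ω (z (σ k) s) s, fun i : Fin n => x i s)) =
      ENNReal.ofReal (ecpf (G₀.real Set.univ) ρ q.2) •
        ((Measure.pi fun _ : Fin q.1 => baseLaw G₀) ⊗ₘ observationKernel κ q.2) := by
  have := isProbabilityMeasure_baseLaw G₀ hG₀
  have hmeas := h.measurable_cluster σ
  have hfin : IsFiniteMeasure (ENNReal.ofReal (ecpf (G₀.real Set.univ) ρ q.2) •
      ((Measure.pi fun _ : Fin q.1 => baseLaw G₀) ⊗ₘ observationKernel κ q.2)) :=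
    Measure.smul_finite _ ENNReal.ofReal_ne_top
  refine ext_prod_pi fun C B hC hB => ?_
  have hCσ : MeasurableSet ((fun (w : Fin n → Ω) k => w (σ k)) ⁻¹' C) :=
    measurable_comp_index σ hC
  have hBm : MeasurableSet (Set.univ.pi B) := MeasurableSet.univ_pi hB
  have h1 : P ((fun s => ((fun k => ω (z (σ k) s) s, fun i => x i s) :
      (Fin q.1 → Ω) × (Fin n → X))) ⁻¹' (C ×ˢ Set.univ.pi B) ∩ labelEvent m z q) =
      P {s | m s = n ∧ (fun i : Fin n => ω (z i s) s) ∈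
        patternSet Ω q.2 ∩ (fun (w : Fin n → Ω) k => w (σ k)) ⁻¹' C ∧
          ∀ i : Fin n, x i s ∈ B i} := by
    refine measure_congr ?_
    have h2 := eventuallyEq_set.1 (h.labelEvent_ae_eq hq)
    refine eventuallyEq_set.2 ?_
    filter_upwards [h2] with s hs
    rw [Set.mem_inter_iff, hs]
    simp only [Set.mem_preimage, Set.mem_prod, Set.mem_univ_pi, Set.mem_inter_iff]
    tauto
  have hκ : Measurable fun v : Fin q.1 → Ω => ∏ i, κ (v (q.2 i)) (B i) :=
    Finset.measurable_prod _ fun i _ =>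
      (κ.measurable_coe (hB i)).comp (measurable_pi_apply (q.2 i))
  rw [Measure.map_apply hmeas (hC.prod hBm),
    Measure.restrict_apply (hmeas (hC.prod hBm)), h1,
    h.measure_sampledAtom_obs ((measurableSet_patternSet q.2).inter hCσ) hB,
    Measure.smul_apply, Measure.compProd_apply_prod hC hBm, smul_eq_mul,
    ← smul_eq_mul, ← lintegral_smul_measure, ← Measure.restrict_smul,
    ← h.map_sampledAtomLaw_restrict_pattern hG₀ hρ hq hσ]
  simp only [observationKernel_apply, Measure.pi_pi]
  rw [setLIntegral_map hC hκ (measurable_comp_index σ), Measure.restrict_restrict hCσ,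
    Set.inter_comm]
  -- On the pattern set each coordinate equals that of its cluster representative, so the kernels `κ
  -- (w i)` depend only on the cluster atoms.
  refine setLIntegral_congr_fun (hCσ.inter (measurableSet_patternSet q.2)) fun w hw => ?_
  refine Finset.prod_congr rfl fun i _ => ?_
  rw [(hw.2 i (σ (q.2 i))).2 (hσ _).symm]

theorem measurableSet_outcome_inter_labelEvent (h : IsCountMixture P ρ G₀ κ r ω m z x) {n : ℕ}
    (q : Labels n) {A : Set (Outcome Ω X)} (hA : MeasurableSet A) :
    MeasurableSet ((fun s => outcome (fun k => ω k s) (fun i : Fin (m s) => z i s)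
      fun i : Fin (m s) => x i s) ⁻¹' A ∩ labelEvent m z q) := by
  by_cases hq : IsAppearanceOrdered q.2
  · rw [preimage_outcome_inter_labelEvent (Function.surjInv_eq hq.1)]
    refine MeasurableSet.inter ?_ (h.measurableSet_labelEvent q)
    exact h.measurable_cluster _ (measurable_outcome_mk q.2 hA)
  · rw [labelEvent_eq_empty hq, Set.inter_empty]
    exact MeasurableSet.empty

theorem measurable_outcome (h : IsCountMixture P ρ G₀ κ r ω m z x) :
    Measurable fun s => outcome (fun k => ω k s) (fun i : Fin (m s) => z i s)
      fun i : Fin (m s) => x i s := by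
  intro A hA
  rw [preimage_eq_iUnion_labelEvent m z (_ ⁻¹' A)]
  exact MeasurableSet.iUnion fun n => MeasurableSet.iUnion fun q =>
    h.measurableSet_outcome_inter_labelEvent q hA

theorem measure_outcome_inter_labelEvent (h : IsCountMixture P ρ G₀ κ r ω m z x)
    [IsProbabilityMeasure P] [IsFiniteMeasure G₀] [NullSingletonClass G₀] (hG₀ : G₀ ≠ 0)
    [MeasurableSpace.CountablySeparated Ω] [IsMarkovKernel κ] (hρ : IsLevyMeasure ρ) {n : ℕ}
    (q : Labels n) {A : Set (Outcome Ω X)} (hA : MeasurableSet A) :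
    P ((fun s => outcome (fun k => ω k s) (fun i : Fin (m s) => z i s)
        fun i : Fin (m s) => x i s) ⁻¹' A ∩ labelEvent m z q) =
      ENNReal.ofReal (ecpf (G₀.real Set.univ) ρ q.2) * outcomeLaw G₀ κ q.2 A := by
  by_cases hq : IsAppearanceOrdered q.2
  · have hmeas := h.measurable_cluster (Function.surjInv hq.1)
    have hA' := measurable_outcome_mk q.2 hA
    rw [preimage_outcome_inter_labelEvent (Function.surjInv_eq hq.1),
      ← Measure.restrict_apply (hmeas hA'), ← Measure.map_apply hmeas hA',
      h.map_restrict_labelEvent hG₀ hρ hq (Function.surjInv_eq hq.1), Measure.smul_apply,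
      outcomeLaw, Measure.map_apply (measurable_outcome_mk q.2) hA, smul_eq_mul]
  · rw [labelEvent_eq_empty hq, ecpf, if_neg hq]
    simp

theorem measure_labelEvent (h : IsCountMixture P ρ G₀ κ r ω m z x)
    [IsProbabilityMeasure P] [IsFiniteMeasure G₀] [NullSingletonClass G₀] (hG₀ : G₀ ≠ 0)
    [MeasurableSpace.CountablySeparated Ω] [IsMarkovKernel κ] (hρ : IsLevyMeasure ρ) {n : ℕ}
    (q : Labels n) :
    P (labelEvent m z q) = ENNReal.ofReal (ecpf (G₀.real Set.univ) ρ q.2) := by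
  have h1 := h.measure_outcome_inter_labelEvent hG₀ hρ q MeasurableSet.univ
  have := isProbabilityMeasure_outcomeLaw G₀ hG₀ κ q.2
  simpa using h1

/-! ### Marginal, conditional and joint laws -/

theorem measure_size (h : IsCountMixture P ρ G₀ κ r ω m z x) [IsProbabilityMeasure P]
    [IsFiniteMeasure G₀] [IsMarkovKernel κ] (hρ : IsLevyMeasure ρ) (n : ℕ) :
    P {s | m s = n} = ENNReal.ofReal (sizePMF (G₀.real Set.univ) ρ n) := by
  rw [← h.measureReal_size hρ, ofReal_measureReal]

theorem sizePMF_nonneg (h : IsCountMixture P ρ G₀ κ r ω m z x) [IsProbabilityMeasure P]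
    [IsFiniteMeasure G₀] [IsMarkovKernel κ] (hρ : IsLevyMeasure ρ) (n : ℕ) :
    0 ≤ sizePMF (G₀.real Set.univ) ρ n := by
  rw [← h.measureReal_size hρ]
  exact measureReal_nonneg

theorem hasSum_sizePMF (h : IsCountMixture P ρ G₀ κ r ω m z x) [IsProbabilityMeasure P]
    [IsFiniteMeasure G₀] [IsMarkovKernel κ] (hρ : IsLevyMeasure ρ) :
    HasSum (sizePMF (G₀.real Set.univ) ρ) 1 := by
  have h1 : ∑' n, P {s | m s = n} = 1 := by
    rw [← measure_iUnion _ h.measurableSet_size]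
    · rw [show ⋃ n, {s | m s = n} = Set.univ by ext; simp, measure_univ]
    · intro n n' hn
      rw [Function.onFun, Set.disjoint_left]
      exact fun s hs hs' => hn (hs.symm.trans hs')
  have h2 := ENNReal.hasSum_toReal (h1.trans_ne ENNReal.one_ne_top)
  rw [← ENNReal.tsum_toReal_eq fun n => measure_ne_top _ _, h1, ENNReal.toReal_one] at h2
  convert h2 using 1
  funext n
  exact (h.measureReal_size hρ n).symm

theorem map_size (h : IsCountMixture P ρ G₀ κ r ω m z x) [IsProbabilityMeasure P]
    [IsFiniteMeasure G₀] [IsMarkovKernel κ] (hρ : IsLevyMeasure ρ) :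
    P.map m = sizeLaw (G₀.real Set.univ) ρ := by
  refine Measure.ext_of_singleton fun n => ?_
  rw [Measure.map_apply h.measurable_size (measurableSet_singleton n), sizeLaw,
    Measure.sum_smul_dirac_singleton]
  exact h.measure_size hρ n

theorem sizePMF_mul_eppf (h : IsCountMixture P ρ G₀ κ r ω m z x)
    [IsProbabilityMeasure P] [IsFiniteMeasure G₀] [NullSingletonClass G₀] (hG₀ : G₀ ≠ 0)
    [MeasurableSpace.CountablySeparated Ω] [IsMarkovKernel κ] (hρ : IsLevyMeasure ρ) {n : ℕ}
    (q : Labels n) :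
    ENNReal.ofReal (sizePMF (G₀.real Set.univ) ρ n) *
      ENNReal.ofReal (eppf (G₀.real Set.univ) ρ q.2) =
        ENNReal.ofReal (ecpf (G₀.real Set.univ) ρ q.2) := by
  rw [← ENNReal.ofReal_mul (h.sizePMF_nonneg hρ n), eppf]
  -- If `f_M(n) = 0`, the EPPF takes the default value of division by zero, but the label event is
  -- null, so the ECPF contributes nothing either.
  by_cases h0 : sizePMF (G₀.real Set.univ) ρ n = 0
  · rw [h0, zero_mul, ENNReal.ofReal_zero, ← h.measure_labelEvent hG₀ hρ q]
    have h1 : P {s | m s = n} = 0 := by rw [h.measure_size hρ, h0, ENNReal.ofReal_zero]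
    exact (measure_mono_null (fun s hs => hs.1) h1).symm
  · rw [mul_div_cancel₀ _ h0]

/-- The label events partition `{m = n}`, so the ECPF sums to `f_M(n)`. Label sequences not in order
of appearance contribute zero. -/
theorem hasSum_eppf (h : IsCountMixture P ρ G₀ κ r ω m z x)
    [IsProbabilityMeasure P] [IsFiniteMeasure G₀] [NullSingletonClass G₀] (hG₀ : G₀ ≠ 0)
    [MeasurableSpace.CountablySeparated Ω] [IsMarkovKernel κ] (hρ : IsLevyMeasure ρ) {n : ℕ}
    (hn : sizePMF (G₀.real Set.univ) ρ n ≠ 0) :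
    HasSum (fun q : Labels n => eppf (G₀.real Set.univ) ρ q.2) 1 := by
  have h1 : ∑' q : Labels n, P (labelEvent m z q) = P {s | m s = n} := by
    rw [← iUnion_labelEvent m z n, measure_iUnion (pairwise_disjoint_labelEvent m z n)
      h.measurableSet_labelEvent]
  have h2 := ENNReal.hasSum_toReal (h1.trans_ne (measure_ne_top _ _))
  rw [← ENNReal.tsum_toReal_eq fun n => measure_ne_top _ _, h1, h.measure_size hρ,
    ENNReal.toReal_ofReal (h.sizePMF_nonneg hρ n)] at h2
  have h3 := h2.div_const (sizePMF (G₀.real Set.univ) ρ n)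
  rw [div_self hn] at h3
  refine h3.congr_fun ?_
  intro q
  rw [h.measure_labelEvent hG₀ hρ, ENNReal.toReal_ofReal (ecpf_nonneg hρ measureReal_nonneg _),
    eppf]

theorem cond_size_labelEvent (h : IsCountMixture P ρ G₀ κ r ω m z x)
    [IsProbabilityMeasure P] [IsFiniteMeasure G₀] [NullSingletonClass G₀] (hG₀ : G₀ ≠ 0)
    [MeasurableSpace.CountablySeparated Ω] [IsMarkovKernel κ] (hρ : IsLevyMeasure ρ) {n : ℕ}
    (hn : sizePMF (G₀.real Set.univ) ρ n ≠ 0) (q : Labels n) :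
    (ProbabilityTheory.cond P {s | m s = n})
      {s | (⟨_, relabel fun i : Fin n => z i s⟩ : Labels n) = q} =
        ENNReal.ofReal (eppf (G₀.real Set.univ) ρ q.2) := by
  have hpos : 0 < sizePMF (G₀.real Set.univ) ρ n :=
    lt_of_le_of_ne (h.sizePMF_nonneg hρ n) hn.symm
  have h1 : P ({s | m s = n} ∩ {s | (⟨_, relabel fun i : Fin n => z i s⟩ : Labels n) = q}) =
      P (labelEvent m z q) := rfl
  rw [cond_apply (h.measurableSet_size n), h1, h.measure_labelEvent hG₀ hρ, h.measure_size hρ,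
    eppf, ENNReal.ofReal_div_of_pos hpos, mul_comm, div_eq_mul_inv]

theorem map_outcome (h : IsCountMixture P ρ G₀ κ r ω m z x)
    [IsProbabilityMeasure P] [IsFiniteMeasure G₀] [NullSingletonClass G₀] (hG₀ : G₀ ≠ 0)
    [MeasurableSpace.CountablySeparated Ω] [IsMarkovKernel κ] (hρ : IsLevyMeasure ρ) :
    P.map (fun s => outcome (fun k => ω k s) (fun i : Fin (m s) => z i s)
      fun i : Fin (m s) => x i s) = twoStepLaw ρ G₀ κ := by
  ext A hA
  rw [Measure.map_apply h.measurable_outcome hA, twoStepLaw_apply ρ G₀ κ hA,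
    preimage_eq_iUnion_labelEvent m z (_ ⁻¹' A), measure_iUnion]
  · refine tsum_congr fun n => ?_
    rw [measure_iUnion]
    · refine tsum_congr fun q => ?_
      rw [h.measure_outcome_inter_labelEvent hG₀ hρ q hA, ← mul_assoc,
        h.sizePMF_mul_eppf hG₀ hρ]
    · exact fun q q' hq => (pairwise_disjoint_labelEvent m z n hq).mono Set.inter_subset_right
        Set.inter_subset_right
    · exact fun q => h.measurableSet_outcome_inter_labelEvent q hA
  · intro n n' hn
    rw [Function.onFun, Set.disjoint_left]
    intro s hs hs'
    obtain ⟨q, hq⟩ := Set.mem_iUnion.1 hs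
    obtain ⟨q', hq'⟩ := Set.mem_iUnion.1 hs'
    exact hn (hq.2.1.symm.trans hq'.2.1)
  · exact fun n => MeasurableSet.iUnion fun q => h.measurableSet_outcome_inter_labelEvent q hA

end IsCountMixture

end

end CountMixture

end

theorem mainTheorem6 {S Ω X : Type*} [MeasurableSpace S] [MeasurableSpace Ω]
    [MeasurableSpace.CountablySeparated Ω] [MeasurableSpace X]
    (P : Measure S) [IsProbabilityMeasure P]
    (ρ : Measure ℝ) (hρ : CountMixture.IsLevyMeasure ρ)
    (G₀ : Measure Ω) [IsFiniteMeasure G₀] [NullSingletonClass G₀] (hG₀ : G₀ ≠ 0)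
    (κ : Kernel Ω X) [IsMarkovKernel κ]
    (r : ℕ → S → ℝ≥0) (ω : ℕ → S → Ω) (m : S → ℕ) (z : ℕ → S → ℕ) (x : ℕ → S → X)
    (hmodel : CountMixture.IsCountMixture P ρ G₀ κ r ω m z x) :
    -- `f_M` is a probability mass function, and it is the marginal law of the sample size
    (∀ n, 0 ≤ CountMixture.sizePMF (G₀.real Set.univ) ρ n) ∧
    HasSum (CountMixture.sizePMF (G₀.real Set.univ) ρ) 1 ∧
    P.map m = CountMixture.sizeLaw (G₀.real Set.univ) ρ ∧
    -- the EPPF is a probability mass function, and it is the conditional law of the labels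
    (∀ (n l : ℕ) (y : Fin n → Fin l), 0 ≤ CountMixture.eppf (G₀.real Set.univ) ρ y) ∧
    (∀ n, CountMixture.sizePMF (G₀.real Set.univ) ρ n ≠ 0 →
      HasSum (fun q : CountMixture.Labels n =>
        CountMixture.eppf (G₀.real Set.univ) ρ q.2) 1) ∧
    (∀ n, CountMixture.sizePMF (G₀.real Set.univ) ρ n ≠ 0 → ∀ q : CountMixture.Labels n,
      (ProbabilityTheory.cond P {s | m s = n})
        {s | (⟨_, CountMixture.relabel fun i : Fin n => z i s⟩ : CountMixture.Labels n) = q} =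
        ENNReal.ofReal (CountMixture.eppf (G₀.real Set.univ) ρ q.2)) ∧
    -- the count-mixture model and the two-step construction have the same law
    P.map (fun s => CountMixture.outcome (fun k => ω k s) (fun i : Fin (m s) => z i s)
      (fun i : Fin (m s) => x i s)) = CountMixture.twoStepLaw ρ G₀ κ :=
  ⟨hmodel.sizePMF_nonneg hρ, hmodel.hasSum_sizePMF hρ, hmodel.map_size hρ,
    fun n _ y => div_nonneg (CountMixture.ecpf_nonneg hρ measureReal_nonneg y)
      (hmodel.sizePMF_nonneg hρ n),
    fun _ hn => hmodel.hasSum_eppf hG₀ hρ hn, fun _ hn q => hmodel.cond_size_labelEvent hG₀ hρ hn q,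
    hmodel.map_outcome hG₀ hρ⟩
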